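/- Let $n,m,p$ be non-negative integers, and let $N$ be the set of triples $\Theta=(A,B,C)$ with $A\in\mathbb R^{n\times n}$ symmetric positive definite, $B\in\mathbb R^{n\times m}$, $C\in\mathbb R^{p\times n}$, such that the discrete-time system $x_{k+1}=Ax_k+Bu_k$, $y_k=Cx_k$ is controllable and observable. $N$ is an open subset of $\mathrm{Sym}(n)\times\mathbb R^{n\times m}\times\mathbb R^{p\times n}$, where $\mathrm{Sym}(n)$ denotes the symmetric $n\times n$ matrices; equip it with the Riemannian metric $$\langle(\xi_1,\eta_1,\zeta_1),(\xi_2,\eta_2,\zeta_2)\rangle_\Theta=\mathrm{tr}(A^{-1}\xi_1A^{-1}\xi_2)+\mathrm{tr}(\eta_1^T\eta_2)+\mathrm{tr}(\zeta_1^T\zeta_2).$$ For $U$ in the orthogonal group $O(n)$ let $\phi_U:N\to N$, $\phi_U(\Theta)=U\circ\Theta=(U^TAU,U^TB,CU)$. Let $N/O(n)$ be the set of equivalence classes $[\Theta]=\{\phi_U(\Theta): U\in O(n)\}$ with the quotient topology, and let $\pi:N\to N/O(n)$, $\pi(\Theta)=[\Theta]$. The space $N/O(n)$ carries a smooth manifold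 structure (Hausdorff, second countable) for which $\pi$ is a smooth submersion; equip it with such a structure (it is unique). For $\Theta\in N$ let the vertical space $\mathcal V_\Theta=T_\Theta\pi^{-1}([\Theta])$ be the tangent space of the fibre through $\Theta$, and let the horizontal space $\mathcal H_\Theta$ be its orthogonal complement in $T_\Theta N$ with respect to $\langle\cdot,\cdot\rangle_\Theta$. The horizontal lift $\bar\xi_\Theta$ at $\Theta$ of a tangent vector $\xi\in T_{[\Theta]}(N/O(n))$ is the unique element of $\mathcal H_\Theta$ with $\mathrm D\pi(\Theta)[\bar\xi_\Theta]=\xi$. Then for every $\Theta\in N$, every $\xi\in T_{[\Theta]}(N/O(n))$ and every $U\in O(n)$, the horizontal lifts $\bar\xi_\Theta$ and $\bar\xi_{\phi_U(\Theta)}$ of $\xi$ at $\Theta$ and at $\phi_U(\Theta)$ exist and are unique, and $$\bar\xi_{\phi_U(\Theta)}=\mathrm D\phi_U(\Theta)[\bar\xi_\Theta].$$ -/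

import Mathlib

open scoped Matrix Manifold ContDiff Topology Matrix.Norms.Elementwise

noncomputable section

namespace SymSys

/-- The vector space `Sym(n)` of real symmetric `n × n` matrices. -/
abbrev Sym (n : ℕ) : Submodule ℝ (Matrix (Fin n) (Fin n) ℝ) where
  carrier := {A | Aᵀ = A}
  add_mem' {A B} hA hB := by
    show (A + B)ᵀ = A + B
    rw [Matrix.transpose_add, hA, hB]
  zero_mem' := Matrix.transpose_zero
  smul_mem' c A hA := by
    show (c • A)ᵀ = c • A
    rw [Matrix.transpose_smul, hA]

/-- The vector space `Sym(n) × ℝ^{n×m} × ℝ^{p×n}`. -/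
def Triple (n m p : ℕ) : Type :=
  Sym n × Matrix (Fin n) (Fin m) ℝ × Matrix (Fin p) (Fin n) ℝ

instance (n m p : ℕ) : NormedAddCommGroup (Triple n m p) :=
  inferInstanceAs (NormedAddCommGroup
    (Sym n × Matrix (Fin n) (Fin m) ℝ × Matrix (Fin p) (Fin n) ℝ))

instance (n m p : ℕ) : NormedSpace ℝ (Triple n m p) :=
  inferInstanceAs (NormedSpace ℝ
    (Sym n × Matrix (Fin n) (Fin m) ℝ × Matrix (Fin p) (Fin n) ℝ))

instance (n m p : ℕ) : FiniteDimensional ℝ (Triple n m p) :=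
  inferInstanceAs (FiniteDimensional ℝ
    (Sym n × Matrix (Fin n) (Fin m) ℝ × Matrix (Fin p) (Fin n) ℝ))

theorem continuous_A (n m p : ℕ) : Continuous fun Θ : Triple n m p => Θ.1 :=
  continuous_fst (X := Sym n) (Y := Matrix (Fin n) (Fin m) ℝ × Matrix (Fin p) (Fin n) ℝ)

theorem continuous_B (n m p : ℕ) : Continuous fun Θ : Triple n m p => Θ.2.1 :=
  (continuous_fst (X := Matrix (Fin n) (Fin m) ℝ) (Y := Matrix (Fin p) (Fin n) ℝ)).comp
    (continuous_snd (X := Sym n) (Y := Matrix (Fin n) (Fin m) ℝ × Matrix (Fin p) (Fin n) ℝ))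

theorem continuous_C (n m p : ℕ) : Continuous fun Θ : Triple n m p => Θ.2.2 :=
  (continuous_snd (X := Matrix (Fin n) (Fin m) ℝ) (Y := Matrix (Fin p) (Fin n) ℝ)).comp
    (continuous_snd (X := Sym n) (Y := Matrix (Fin n) (Fin m) ℝ × Matrix (Fin p) (Fin n) ℝ))

/-- The state at time `k` of the system `x_{k+1} = A x_k + B u_k` started at `x₀` and driven by
the input sequence `u`. -/
def state {n m : ℕ} (A : Matrix (Fin n) (Fin n) ℝ) (B : Matrix (Fin n) (Fin m) ℝ)
    (x₀ : Fin n → ℝ) (u : ℕ → Fin m → ℝ) : ℕ → Fin n → ℝ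
  | 0 => x₀
  | k + 1 => A *ᵥ state A B x₀ u k + B *ᵥ u k

/-- The output `y_k = C x_k`. -/
def output {n m p : ℕ} (A : Matrix (Fin n) (Fin n) ℝ) (B : Matrix (Fin n) (Fin m) ℝ)
    (C : Matrix (Fin p) (Fin n) ℝ) (x₀ : Fin n → ℝ) (u : ℕ → Fin m → ℝ) (k : ℕ) : Fin p → ℝ :=
  C *ᵥ state A B x₀ u k

/-- Controllability: every state can be steered to every other state in finite time. -/
def IsControllable {n m : ℕ} (A : Matrix (Fin n) (Fin n) ℝ) (B : Matrix (Fin n) (Fin m) ℝ) :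
    Prop :=
  ∀ x₀ x₁ : Fin n → ℝ, ∃ (u : ℕ → Fin m → ℝ) (T : ℕ), state A B x₀ u T = x₁

/-- Observability: distinct initial states are distinguished by the outputs for some input. -/
def IsObservable {n m p : ℕ} (A : Matrix (Fin n) (Fin n) ℝ) (B : Matrix (Fin n) (Fin m) ℝ)
    (C : Matrix (Fin p) (Fin n) ℝ) : Prop :=
  ∀ x₀ x₀' : Fin n → ℝ, x₀ ≠ x₀' →
    ∃ (u : ℕ → Fin m → ℝ) (k : ℕ), output A B C x₀ u k ≠ output A B C x₀' u k

/-- The set underlying `N`: `A` is positive definite, and `(A, B, C)` is controllable and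
observable. -/
def carrierN (n m p : ℕ) : Set (Triple n m p) :=
  {Θ | (Θ.1 : Matrix (Fin n) (Fin n) ℝ).PosDef ∧ IsControllable Θ.1.1 Θ.2.1 ∧
    IsObservable Θ.1.1 Θ.2.1 Θ.2.2}

/-! `N` is open in `Sym(n) × ℝ^{n×m} × ℝ^{p×n}`. -/

theorem state_eq {n m : ℕ} (A : Matrix (Fin n) (Fin n) ℝ) (B : Matrix (Fin n) (Fin m) ℝ)
    (x₀ : Fin n → ℝ) (u : ℕ → Fin m → ℝ) (k : ℕ) :
    state A B x₀ u k = (A ^ k) *ᵥ x₀ + state A B 0 u k := by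
  induction k with
  | zero => simp [state]
  | succ k ih =>
    rw [state, ih, state, Matrix.mulVec_add, Matrix.mulVec_mulVec, ← pow_succ', add_assoc]

theorem state_sum {n m : ℕ} (A : Matrix (Fin n) (Fin n) ℝ) (B : Matrix (Fin n) (Fin m) ℝ)
    (u : Fin n → ℕ → Fin m → ℝ) (c : Fin n → ℝ) (k : ℕ) :
    state A B 0 (fun j => ∑ i, c i • u i j) k = ∑ i, c i • state A B 0 (u i) k := by
  induction k with
  | zero => simp [state]
  | succ k ih =>
    rw [state, ih]
    simp only [state, Matrix.mulVec_sum, Matrix.mulVec_smul, smul_add, Finset.sum_add_distrib]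

theorem state_delay {n m : ℕ} (A : Matrix (Fin n) (Fin n) ℝ) (B : Matrix (Fin n) (Fin m) ℝ)
    (u : ℕ → Fin m → ℝ) (s k : ℕ) :
    state A B 0 (fun j => if j < s then 0 else u (j - s)) (s + k) = state A B 0 u k := by
  induction k with
  | zero =>
    have : ∀ j ≤ s, state A B 0 (fun j => if j < s then 0 else u (j - s)) j = 0 := by
      intro j hj
      induction j with
      | zero => rfl
      | succ j ih => rw [state, ih (by omega)]; simp [show j < s by omega]
    simpa [state] using this s le_rfl
  | succ k ih =>
    rw [← add_assoc, state, ih, state]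
    simp

theorem continuous_state {n m : ℕ} (u : ℕ → Fin m → ℝ) (k : ℕ) :
    Continuous fun P : Matrix (Fin n) (Fin n) ℝ × Matrix (Fin n) (Fin m) ℝ =>
      state P.1 P.2 0 u k := by
  induction k with
  | zero => exact continuous_const
  | succ k ih =>
    exact (continuous_fst.matrix_mulVec ih).add (continuous_snd.matrix_mulVec continuous_const)

theorem isOpen_controllable (n m : ℕ) :
    IsOpen {P : Matrix (Fin n) (Fin n) ℝ × Matrix (Fin n) (Fin m) ℝ |
      IsControllable P.1 P.2} := by
  rw [isOpen_iff_mem_nhds]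
  rintro ⟨A, B⟩ h
  choose v S hv using fun i : Fin n => h 0 (Pi.single i 1)
  set T : ℕ := ∑ i, S i with hT
  have hST : ∀ i, S i ≤ T := fun i => Finset.single_le_sum (fun _ _ => Nat.zero_le _)
    (Finset.mem_univ i)
  set w : Fin n → ℕ → Fin m → ℝ :=
    fun i j => if j < T - S i then 0 else v i (j - (T - S i)) with hw
  have hwT : ∀ i, state A B 0 (w i) T = Pi.single i 1 := by
    intro i
    have := state_delay A B (v i) (T - S i) (S i)
    rw [Nat.sub_add_cancel (hST i), hv i] at this
    exact this
  let R : Matrix (Fin n) (Fin n) ℝ × Matrix (Fin n) (Fin m) ℝ → Matrix (Fin n) (Fin n) ℝ :=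
    fun P => (Matrix.of fun i => state P.1 P.2 0 (w i) T)ᵀ
  have hR : Continuous R :=
    (continuous_pi fun i => continuous_state (w i) T).matrix_transpose
  have hR0 : R (A, B) = 1 := by
    ext a b
    simp [R, hwT, Matrix.one_apply, Pi.single_apply]
  have hdet : ∀ᶠ P in 𝓝 (A, B), (R P).det ≠ 0 :=
    hR.matrix_det.continuousAt.eventually_ne (by simp [hR0])
  filter_upwards [hdet] with P hP x₀ x₁
  have hu : IsUnit (R P).det := isUnit_iff_ne_zero.mpr hP
  let c : Fin n → ℝ := (R P)⁻¹ *ᵥ (x₁ - (P.1 ^ T) *ᵥ x₀)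
  refine ⟨fun j => ∑ i, c i • w i j, T, ?_⟩
  rw [state_eq, state_sum]
  have h1 : R P *ᵥ c = x₁ - (P.1 ^ T) *ᵥ x₀ := by
    simp [c, Matrix.mulVec_mulVec, Matrix.mul_nonsing_inv _ hu]
  have h2 : R P *ᵥ c = ∑ i, c i • state P.1 P.2 0 (w i) T := by
    ext a
    simp [R, Matrix.mulVec, dotProduct, mul_comm]
  rw [← h2, h1]
  abel

theorem isObservable_iff {n m p : ℕ} (A : Matrix (Fin n) (Fin n) ℝ)
    (B : Matrix (Fin n) (Fin m) ℝ) (C : Matrix (Fin p) (Fin n) ℝ) :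
    IsObservable A B C ↔
      ∀ x ∈ Metric.sphere (0 : Fin n → ℝ) 1, ∃ k : ℕ, (C * A ^ k) *ᵥ x ≠ 0 := by
  have key : ∀ x x' u k, output A B C x u k - output A B C x' u k = (C * A ^ k) *ᵥ (x - x') := by
    intro x x' u k
    rw [output, output, state_eq A B x, state_eq A B x', Matrix.mulVec_add, Matrix.mulVec_add,
      Matrix.mulVec_mulVec, Matrix.mulVec_mulVec, Matrix.mulVec_sub]
    abel
  constructor
  · intro h x hx
    have hx0 : x ≠ 0 := by
      rintro rfl
      simp at hx
    obtain ⟨u, k, hk⟩ := h x 0 hx0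
    refine ⟨k, ?_⟩
    have := key x 0 u k
    rw [sub_zero] at this
    rw [← this]
    exact sub_ne_zero.mpr hk
  · intro h x x' hx
    have hd : x - x' ≠ 0 := sub_ne_zero.mpr hx
    obtain ⟨k, hk⟩ := h (‖x - x'‖⁻¹ • (x - x')) (by
      simp [norm_smul, norm_ne_zero_iff.mpr hd])
    refine ⟨0, k, sub_ne_zero.mp ?_⟩
    rw [key]
    intro h0
    exact hk (by rw [Matrix.mulVec_smul, h0, smul_zero])

theorem isOpen_observable (n m p : ℕ) :
    IsOpen {Θ : Triple n m p | IsObservable Θ.1.1 Θ.2.1 Θ.2.2} := by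
  rw [isOpen_iff_mem_nhds]
  intro Θ₀ h
  have h' := (isObservable_iff _ _ _).1 h
  have := (isCompact_sphere (0 : Fin n → ℝ) 1).eventually_forall_of_forall_eventually
    (x₀ := Θ₀) (P := fun Θ x => ∃ k : ℕ, (Θ.2.2 * Θ.1.1 ^ k) *ᵥ x ≠ 0) (by
      intro x hx
      obtain ⟨k, hk⟩ := h' x hx
      have hc : Continuous fun z : Triple n m p × (Fin n → ℝ) =>
          (z.1.2.2 * z.1.1.1 ^ k) *ᵥ z.2 :=
        (((continuous_C n m p).comp continuous_fst).matrix_mul ((continuous_subtype_val.comp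
          ((continuous_A n m p).comp continuous_fst)).pow k)).matrix_mulVec continuous_snd
      filter_upwards [hc.continuousAt.eventually_ne (x := (Θ₀, x)) hk] with z hz
      exact ⟨k, hz⟩)
  filter_upwards [this] with Θ hΘ
  exact (isObservable_iff _ _ _).2 hΘ

theorem isOpen_posDef (n : ℕ) :
    IsOpen {A : Sym n | (A : Matrix (Fin n) (Fin n) ℝ).PosDef} := by
  have hiff : ∀ A : Sym n, (A : Matrix (Fin n) (Fin n) ℝ).PosDef ↔
      ∀ x ∈ Metric.sphere (0 : Fin n → ℝ) 1, 0 < x ⬝ᵥ (A.1 *ᵥ x) := by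
    intro A
    rw [Matrix.posDef_iff_dotProduct_mulVec]
    constructor
    · rintro ⟨-, h⟩ x hx
      have hx0 : x ≠ 0 := by
        rintro rfl
        simp at hx
      simpa using h hx0
    · intro h
      refine ⟨(Matrix.conjTranspose_eq_transpose_of_trivial A.1).trans A.2, fun x hx => ?_⟩
      have h1 := h (‖x‖⁻¹ • x) (by simp [norm_smul, norm_ne_zero_iff.mpr hx])
      rw [Matrix.mulVec_smul, smul_dotProduct, dotProduct_smul, smul_smul, smul_eq_mul] at h1
      simpa using (pos_iff_pos_of_mul_pos h1).1
        (mul_pos (inv_pos.mpr (norm_pos_iff.mpr hx)) (inv_pos.mpr (norm_pos_iff.mpr hx)))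
  rw [isOpen_iff_mem_nhds]
  intro A₀ h
  have := (isCompact_sphere (0 : Fin n → ℝ) 1).eventually_forall_of_forall_eventually
    (x₀ := A₀) (P := fun A x => 0 < x ⬝ᵥ (A.1 *ᵥ x)) (by
      intro x hx
      have hc : Continuous fun z : Sym n × (Fin n → ℝ) => z.2 ⬝ᵥ (z.1.1 *ᵥ z.2) := by fun_prop
      exact (hc.continuousAt (x := (A₀, x))).eventually (lt_mem_nhds ((hiff A₀).1 h x hx)))
  filter_upwards [this] with A hA
  exact (hiff A).2 hA

theorem isOpen_carrierN (n m p : ℕ) : IsOpen (carrierN n m p) := by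
  refine ((isOpen_posDef n).preimage (continuous_A n m p)).inter
    (IsOpen.inter ?_ (isOpen_observable n m p))
  exact (isOpen_controllable n m).preimage
    (f := fun Θ : Triple n m p => (Θ.1.1, Θ.2.1))
    ((continuous_subtype_val.comp (continuous_A n m p)).prodMk (continuous_B n m p))

/-- The manifold `N`, an open submanifold of `Sym(n) × ℝ^{n×m} × ℝ^{p×n}`. -/
def N (n m p : ℕ) : TopologicalSpace.Opens (Triple n m p) :=
  ⟨carrierN n m p, isOpen_carrierN n m p⟩

/-- The orthogonal group `O(n)`. -/
abbrev O (n : ℕ) : Type := Matrix.orthogonalGroup (Fin n) ℝ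

theorem O_transpose_mul {n : ℕ} (U : O n) : U.1ᵀ * U.1 = 1 :=
  (Matrix.mem_orthogonalGroup_iff' _ _).1 U.2

theorem O_mul_transpose {n : ℕ} (U : O n) : U.1 * U.1ᵀ = 1 :=
  (Matrix.mem_orthogonalGroup_iff _ _).1 U.2

/-- `U ∘ Θ = (Uᵀ A U, Uᵀ B, C U)` for `Θ = (A, B, C)`. -/
def act {n m p : ℕ} (U : O n) (Θ : Triple n m p) : Triple n m p :=
  (⟨U.1ᵀ * Θ.1.1 * U.1, by
    show (U.1ᵀ * Θ.1.1 * U.1)ᵀ = U.1ᵀ * Θ.1.1 * U.1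
    have h : Θ.1.1ᵀ = Θ.1.1 := Θ.1.2
    rw [Matrix.transpose_mul, Matrix.transpose_mul, Matrix.transpose_transpose, h,
      Matrix.mul_assoc]⟩, U.1ᵀ * Θ.2.1, Θ.2.2 * U.1)

theorem act_one {n m p : ℕ} (Θ : Triple n m p) : act 1 Θ = Θ := by
  refine Prod.ext (Subtype.ext ?_) (Prod.ext ?_ ?_) <;> simp [act]

theorem act_act {n m p : ℕ} (U V : O n) (Θ : Triple n m p) :
    act V (act U Θ) = act (U * V) Θ := by
  refine Prod.ext (Subtype.ext ?_) (Prod.ext ?_ ?_) <;>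
    simp [act, Matrix.transpose_mul, Matrix.mul_assoc]

theorem state_act {n m p : ℕ} (U : O n) (Θ : Triple n m p) (x₀ : Fin n → ℝ)
    (u : ℕ → Fin m → ℝ) (k : ℕ) :
    state (act U Θ).1.1 (act U Θ).2.1 x₀ u k = U.1ᵀ *ᵥ state Θ.1.1 Θ.2.1 (U.1 *ᵥ x₀) u k := by
  induction k with
  | zero => simp [state, Matrix.mulVec_mulVec, O_transpose_mul]
  | succ k ih =>
    rw [state, ih, state]
    simp only [act, Matrix.mulVec_add, Matrix.mulVec_mulVec, Matrix.mul_assoc]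
    rw [O_mul_transpose, Matrix.mul_one]

theorem act_mem {n m p : ℕ} (U : O n) {Θ : Triple n m p} (h : Θ ∈ carrierN n m p) :
    act U Θ ∈ carrierN n m p := by
  obtain ⟨hA, hc, ho⟩ := h
  have hinj : Function.Injective (U.1.mulVec) := by
    intro x y hxy
    have := congrArg (fun z => U.1ᵀ *ᵥ z) hxy
    simpa [Matrix.mulVec_mulVec, O_transpose_mul] using this
  refine ⟨?_, ?_, ?_⟩
  · have := hA.conjTranspose_mul_mul_same hinj
    rwa [Matrix.conjTranspose_eq_transpose_of_trivial] at this
  · intro x₀ x₁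
    obtain ⟨u, T, hu⟩ := hc (U.1 *ᵥ x₀) (U.1 *ᵥ x₁)
    refine ⟨u, T, ?_⟩
    rw [state_act, hu, Matrix.mulVec_mulVec, O_transpose_mul, Matrix.one_mulVec]
  · intro x₀ x₀' hx
    obtain ⟨u, k, hk⟩ := ho (U.1 *ᵥ x₀) (U.1 *ᵥ x₀') (fun h => hx (hinj h))
    have key : ∀ x, output (act U Θ).1.1 (act U Θ).2.1 (act U Θ).2.2 x u k =
        output Θ.1.1 Θ.2.1 Θ.2.2 (U.1 *ᵥ x) u k := by
      intro x
      rw [output, state_act, output, Matrix.mulVec_mulVec]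
      simp only [act]
      rw [Matrix.mul_assoc, O_mul_transpose, Matrix.mul_one]
    exact ⟨u, k, by rwa [key, key]⟩

/-- The map `φ_U : N → N`, `φ_U(Θ) = U ∘ Θ`. -/
def phi {n m p : ℕ} (U : O n) (Θ : N n m p) : N n m p :=
  ⟨act U Θ.1, act_mem U Θ.2⟩

/-- `Θ₁ ∼ Θ₂` if and only if `Θ₂ = U ∘ Θ₁` for some `U ∈ O(n)`. -/
instance orbitSetoid (n m p : ℕ) : Setoid (N n m p) where
  r Θ₁ Θ₂ := ∃ U : O n, Θ₂ = phi U Θ₁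
  iseqv :=
    { refl := fun Θ => ⟨1, Subtype.ext (act_one Θ.1).symm⟩
      symm := by
        rintro Θ₁ Θ₂ ⟨U, rfl⟩
        refine ⟨U⁻¹, Subtype.ext ?_⟩
        show Θ₁.1 = act U⁻¹ (act U Θ₁.1)
        rw [act_act, mul_inv_cancel, act_one]
      trans := by
        rintro Θ₁ Θ₂ Θ₃ ⟨U, rfl⟩ ⟨V, rfl⟩
        exact ⟨U * V, Subtype.ext (act_act U V Θ₁.1)⟩ }

/-- The orbit space `N / O(n)`, with the quotient topology. -/
abbrev Orbits (n m p : ℕ) : Type := Quotient (orbitSetoid n m p)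

/-- The canonical projection `π : N → N / O(n)`. -/
def proj {n m p : ℕ} (Θ : N n m p) : Orbits n m p := Quotient.mk _ Θ

/-- The atlas on the topological space `N / O(n)` is that of the quotient manifold: it makes
`N / O(n)` a smooth manifold for which `π` is a smooth submersion (this determines the smooth
structure uniquely). -/
structure IsQuotientManifold (n m p d : ℕ)
    [ChartedSpace (EuclideanSpace ℝ (Fin d)) (Orbits n m p)] : Prop where
  t2 : T2Space (Orbits n m p)
  secondCountable : SecondCountableTopology (Orbits n m p)
  isManifold : IsManifold (𝓡 d) ∞ (Orbits n m p)
  contMDiff_proj : ContMDiff 𝓘(ℝ, Triple n m p) (𝓡 d) ∞ (proj : N n m p → Orbits n m p)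
  surjective_mfderiv_proj : ∀ Θ : N n m p,
    Function.Surjective (mfderiv 𝓘(ℝ, Triple n m p) (𝓡 d) (proj : N n m p → Orbits n m p) Θ)

/-- The Riemannian metric
`⟨(ξ₁,η₁,ζ₁),(ξ₂,η₂,ζ₂)⟩_Θ = tr(A⁻¹ ξ₁ A⁻¹ ξ₂) + tr(η₁ᵀ η₂) + tr(ζ₁ᵀ ζ₂)`. -/
def metric {n m p : ℕ} (Θ : N n m p) (v w : TangentSpace 𝓘(ℝ, Triple n m p) Θ) : ℝ :=
  let v : Triple n m p := v
  let w : Triple n m p := w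
  (Θ.1.1.1⁻¹ * v.1.1 * Θ.1.1.1⁻¹ * w.1.1).trace + (v.2.1ᵀ * w.2.1).trace
    + (v.2.2ᵀ * w.2.2).trace

/-- The vertical space `𝒱_Θ`: the tangent space at `Θ` of the fibre `π⁻¹([Θ])`, that is, the
velocities at `Θ` of the smooth curves of `N` that stay in the fibre. -/
def vertical {n m p : ℕ} (Θ : N n m p) : Set (TangentSpace 𝓘(ℝ, Triple n m p) Θ) :=
  {v | ∃ γ : ℝ → N n m p, ContMDiff 𝓘(ℝ, ℝ) 𝓘(ℝ, Triple n m p) ∞ γ ∧ γ 0 = Θ ∧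
    (∀ t, proj (γ t) = proj Θ) ∧ HasDerivAt (fun t => (γ t : Triple n m p)) v 0}

/-- The horizontal space `ℋ_Θ`: the orthogonal complement of `𝒱_Θ` in `T_Θ N`. -/
def horizontal {n m p : ℕ} (Θ : N n m p) : Set (TangentSpace 𝓘(ℝ, Triple n m p) Θ) :=
  {h | ∀ v ∈ vertical Θ, metric Θ h v = 0}

/-- `h ∈ T_Θ N` is a horizontal lift at `Θ` of the tangent vector `ξ ∈ T_q (N / O(n))`: it is
horizontal, `π(Θ) = q` and `Dπ(Θ)[h] = ξ` (the last two as one equation in the tangent bundle). -/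
def IsHorizontalLift {n m p d : ℕ} [ChartedSpace (EuclideanSpace ℝ (Fin d)) (Orbits n m p)]
    {q : Orbits n m p} (ξ : TangentSpace (𝓡 d) q) (Θ : N n m p)
    (h : TangentSpace 𝓘(ℝ, Triple n m p) Θ) : Prop :=
  h ∈ horizontal Θ ∧
    tangentMap 𝓘(ℝ, Triple n m p) (𝓡 d) (proj : N n m p → Orbits n m p) ⟨Θ, h⟩ = ⟨q, ξ⟩

end SymSys

end

open SymSys

noncomputable section

namespace SymSys

/-! Once vertical vectors are known to be exactly the kernel of Dπ(Θ), the lift formula is short.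
The metric is positive definite, so a submersion has exactly one horizontal preimage of each tangent
vector. Each φ_U is the restriction of a linear map, preserves the metric, and satisfies π ∘ φ_U =
π; hence Dφ_U carries a horizontal lift of ξ to a horizontal lift of ξ (`IsHorizontalLift.map_phi`),
and uniqueness (`existsUnique_horizontalLift`) identifies the two. The equality of `vertical` with
the kernel (`mem_vertical_iff`) comes from the inverse function theorem: a level set of a submersion
contains a curve in every kernel direction.

The longer half is the existence of the quotient manifold. It uses explicit slices. Fixed inputs
that steer 0 to the basis vectors at Θ₀ give, for nearby systems, a frame R(Θ) of reachable states
with R(U ∘ Θ) = Uᵀ R(Θ). Its orthogonal polar factor ρ(Θ) transforms in the same way, so r(Θ) = ρ(Θ)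
∘ Θ is constant on orbits while staying in the orbit (`exists_invariant_retraction`). The image of a
smooth retraction is locally a submanifold (`exists_chart_of_retraction`), and its coordinates are
the charts of the orbit space (`exists_isSliceChart`). The kernel of Dr(Θ₀) is isomorphic to the
skew-symmetric matrices, so all charts have the same dimension. Compactness of O(n) gives the
Hausdorff property. -/

/-! ### Local diffeomorphisms and images of smooth retractions -/

/-- A smooth map whose derivative at a point is the identity is a diffeomorphism near it. -/
theorem exists_local_diffeo {E : Type*} [NormedAddCommGroup E] [NormedSpace ℝ E]
    [CompleteSpace E] {D : Set E} (hD : IsOpen D) {ψ : E → E} (hψ : ContDiffOn ℝ ∞ ψ D)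
    {x₀ : E} (hx₀ : x₀ ∈ D) (hd : HasFDerivAt ψ (ContinuousLinearMap.id ℝ E) x₀) :
    ∃ φ : OpenPartialHomeomorph E E, (φ : E → E) = ψ ∧ x₀ ∈ φ.source ∧ φ.source ⊆ D ∧
      ContDiffOn ℝ ∞ φ.symm φ.target := by
  have hat : ∀ x ∈ D, ContDiffAt ℝ ∞ ψ x := fun x hx => hψ.contDiffAt (hD.mem_nhds hx)
  have hd' : HasFDerivAt ψ ((ContinuousLinearEquiv.refl ℝ E : E ≃L[ℝ] E) : E →L[ℝ] E) x₀ := hd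
  let φ₀ := (hat x₀ hx₀).toOpenPartialHomeomorph ψ hd' (by simp)
  have hφ₀ : (φ₀ : E → E) = ψ := ContDiffAt.toOpenPartialHomeomorph_coe _ _ _
  have hcont : ContinuousOn (fderiv ℝ ψ) D := hψ.continuousOn_fderiv_of_isOpen hD (by simp)
  -- Invertibility of the derivative is an open condition; restricting to it makes the inverse
  -- smooth on the whole target, not only at the image of `x₀`.
  let W : Set E := D ∩ fderiv ℝ ψ ⁻¹' Set.range ((↑) : (E ≃L[ℝ] E) → E →L[ℝ] E)
  have hW : IsOpen W := hcont.isOpen_inter_preimage hD ContinuousLinearEquiv.isOpen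
  have hxW : x₀ ∈ W := ⟨hx₀, ContinuousLinearEquiv.refl ℝ E, hd'.fderiv.symm⟩
  refine ⟨φ₀.restrOpen W hW, hφ₀, ⟨ContDiffAt.mem_toOpenPartialHomeomorph_source _ _ _, hxW⟩,
    fun x hx => hx.2.1, fun y hy => ?_⟩
  have hsrc := (φ₀.restrOpen W hW).map_target hy
  set x := (φ₀.restrOpen W hW).symm y with hx
  obtain ⟨-, hxD, e, he⟩ := hsrc
  refine (OpenPartialHomeomorph.contDiffAt_symm _ hy (f₀' := e) ?_ ?_).contDiffWithinAt
  · rw [he]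
    exact hφ₀ ▸ ((hat x hxD).differentiableAt (by simp)).hasFDerivAt
  · exact hφ₀ ▸ hat x hxD

/-- The image of a smooth retraction `r` is a submanifold: near a fixed point `x₀`, the set of
fixed points has a smooth parametrization `σ`, and `c` gives the coordinates of `r x`. -/
theorem exists_chart_of_retraction {E F : Type*} [NormedAddCommGroup E] [NormedSpace ℝ E]
    [CompleteSpace E] [NormedAddCommGroup F] [NormedSpace ℝ F]
    {D : Set E} (hD : IsOpen D) {r : E → E} (hr : ContDiffOn ℝ ∞ r D) (hrD : Set.MapsTo r D D)
    (hrr : ∀ x ∈ D, r (r x) = r x) {x₀ : E} (hx₀ : x₀ ∈ D) (h0 : r x₀ = x₀)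
    (e : (fderiv ℝ r x₀).range ≃L[ℝ] F) :
    ∃ (V : Set E) (T : Set F) (c : E → F) (σ : F → E), IsOpen V ∧ IsOpen T ∧ V ⊆ D ∧ x₀ ∈ V ∧
      (∀ x ∈ D, r x ∈ V → x ∈ V) ∧ (∀ x ∈ V, r x ∈ V) ∧ ContDiffOn ℝ ∞ c V ∧
      ContDiffOn ℝ ∞ σ T ∧ Set.MapsTo c V T ∧ Set.MapsTo σ T V ∧ (∀ x ∈ V, σ (c x) = r x) ∧
      (∀ y ∈ T, c (σ y) = y) ∧ ∀ x ∈ V, c (r x) = c x := by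
  set P := fderiv ℝ r x₀ with hP
  have hrP : HasFDerivAt r P x₀ :=
    ((hr.contDiffAt (hD.mem_nhds hx₀)).differentiableAt (by simp)).hasFDerivAt
  have hPP : ∀ v, P (P v) = P v := by
    have h1 : HasFDerivAt (r ∘ r) (P.comp P) x₀ :=
      HasFDerivAt.comp x₀ (by rwa [h0]) hrP
    have h2 : r ∘ r =ᶠ[𝓝 x₀] r := by
      filter_upwards [hD.mem_nhds hx₀] with x hx using hrr x hx
    have := h1.unique (hrP.congr_of_eventuallyEq h2)
    exact fun v => DFunLike.congr_fun this v
  let Q : E →L[ℝ] E := ContinuousLinearMap.id ℝ E - P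
  -- `ψ` straightens `r` to its linearization: ψ ∘ r = P ∘ ψ on `D`. Since P² = P, its derivative at
  -- `x₀` is P² + (1 - P)² = 1.
  let ψ : E → E := fun x => P (r x) + Q (x - r x)
  have hψ : ContDiffOn ℝ ∞ ψ D :=
    (P.contDiff.comp_contDiffOn hr).add (Q.contDiff.comp_contDiffOn (contDiffOn_id.sub hr))
  have hψd : HasFDerivAt ψ (ContinuousLinearMap.id ℝ E) x₀ := by
    have := (P.hasFDerivAt.comp x₀ hrP).add
      (Q.hasFDerivAt.comp x₀ ((hasFDerivAt_id x₀).sub hrP))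
    refine this.congr_fderiv ?_
    ext v
    simp [Q, hPP]
  obtain ⟨φ, hφ, hxφ, hφD, hφs⟩ := exists_local_diffeo hD hψ hx₀ hψd
  have hψr : ∀ x ∈ D, ψ (r x) = P (r x) := by
    intro x hx
    simp [ψ, hrr x hx]
  have hPψ : ∀ x, P (ψ x) = P (r x) := by
    intro x
    simp [ψ, Q, hPP]
  let j : F →L[ℝ] E := P.range.subtypeL.comp (e.symm : F →L[ℝ] P.range)
  have hPj : ∀ y, P (j y) = j y := by
    intro y
    obtain ⟨v, hv⟩ := (e.symm y).2
    show P (e.symm y : E) = (e.symm y : E)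
    rw [← hv]
    exact hPP v
  let k : E →L[ℝ] F := (e : P.range →L[ℝ] F).comp (P.codRestrict P.range fun v => ⟨v, rfl⟩)
  have hjk : ∀ x, j (k x) = P x := by
    intro x
    show ((e.symm (e (P.codRestrict P.range _ x)) : P.range) : E) = P x
    rw [e.symm_apply_apply]
    rfl
  have hkj : ∀ y, k (j y) = y := by
    intro y
    have : P.codRestrict P.range (fun v => ⟨v, rfl⟩) (j y) = e.symm y := Subtype.ext (hPj y)
    simp [k, this]
  -- Pulling the domain of `φ` back along `r` makes `V` saturated: for x in `D`, x lies in `V` as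
  -- soon as r x does. For the orbit retraction this makes `V` a union of orbits.
  let V : Set E := D ∩ r ⁻¹' φ.source
  have hV : IsOpen V := hr.continuousOn.isOpen_inter_preimage hD φ.open_source
  let T₀ : Set E := φ.target ∩ φ.symm ⁻¹' V
  have hT₀ : IsOpen T₀ := φ.continuousOn_symm.isOpen_inter_preimage φ.open_target hV
  have hmain : ∀ x ∈ V, φ.symm (P (r x)) = r x ∧ P (r x) ∈ φ.target := by
    intro x hx
    rw [← hψr x hx.1, ← hφ]
    exact ⟨φ.left_inv hx.2, φ.map_source hx.2⟩
  have hrV : ∀ x ∈ V, r x ∈ V := fun x hx => ⟨hrD hx.1, by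
    rw [Set.mem_preimage, hrr x hx.1]
    exact hx.2⟩
  refine ⟨V, j ⁻¹' T₀, fun x => k (r x), fun y => φ.symm (j y), hV, hT₀.preimage j.continuous,
    fun x hx => hx.1, ⟨hx₀, by simpa [h0] using hxφ⟩, ?_, hrV, ?_, ?_, ?_, ?_, ?_, ?_, ?_⟩
  · intro x hx hxr
    refine ⟨hx, ?_⟩
    have := hxr.2
    rwa [Set.mem_preimage, hrr x hx] at this
  · exact k.contDiff.comp_contDiffOn (hr.mono fun x hx => hx.1)
  · exact hφs.comp j.contDiff.contDiffOn fun y hy => hy.1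
  · intro x hx
    show j (k (r x)) ∈ T₀
    rw [hjk]
    refine ⟨(hmain x hx).2, ?_⟩
    rw [Set.mem_preimage, (hmain x hx).1]
    exact hrV x hx
  · intro y hy
    exact hy.2
  · intro x hx
    simp only [hjk]
    exact (hmain x hx).1
  · intro y hy
    have h1 : P (r (φ.symm (j y))) = j y := by
      have : ψ (φ.symm (j y)) = j y := by rw [← hφ]; exact φ.right_inv hy.1
      rw [← hPψ, this, hPj]
    have h2 := congrArg k (hjk (r (φ.symm (j y))))
    rwa [h1, hkj, hkj] at h2
  · intro x hx
    simp only [hrr x hx.1]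

/-! ### Smoothness of matrix operations -/

/-- Matrix multiplication as a continuous bilinear map. -/
def mulL (l m k : ℕ) : Matrix (Fin l) (Fin m) ℝ →L[ℝ] Matrix (Fin m) (Fin k) ℝ →L[ℝ]
    Matrix (Fin l) (Fin k) ℝ :=
  (LinearMap.mk₂ ℝ (fun A B => A * B) Matrix.add_mul Matrix.smul_mul Matrix.mul_add
    (fun c A B => Matrix.mul_smul A c B)).toContinuousBilinearMap

/-- Transposition as a continuous linear map. -/
def transposeL (l m : ℕ) : Matrix (Fin l) (Fin m) ℝ →L[ℝ] Matrix (Fin m) (Fin l) ℝ :=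
  LinearMap.toContinuousLinearMap
    (Matrix.transposeLinearEquiv (Fin l) (Fin m) ℝ ℝ : _ →ₗ[ℝ] _)

/-- The symmetric part `(M + Mᵀ) / 2` of a matrix. -/
def symPart (n : ℕ) : Matrix (Fin n) (Fin n) ℝ →L[ℝ] Sym n :=
  LinearMap.toContinuousLinearMap
    { toFun := fun M => ⟨(2⁻¹ : ℝ) • (M + Mᵀ), by
        show ((2⁻¹ : ℝ) • (M + Mᵀ))ᵀ = (2⁻¹ : ℝ) • (M + Mᵀ)
        rw [Matrix.transpose_smul, Matrix.transpose_add, Matrix.transpose_transpose, add_comm]⟩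
      map_add' := fun M M' => Subtype.ext (by
        show (2⁻¹ : ℝ) • (M + M' + (M + M')ᵀ) = (2⁻¹ : ℝ) • (M + Mᵀ) + (2⁻¹ : ℝ) • (M' + M'ᵀ)
        rw [Matrix.transpose_add, ← smul_add]
        congr 1
        abel)
      map_smul' := fun c M => Subtype.ext (by
        show (2⁻¹ : ℝ) • (c • M + (c • M)ᵀ) = c • (2⁻¹ : ℝ) • (M + Mᵀ)
        rw [Matrix.transpose_smul, ← smul_add, smul_comm]) }

theorem symPart_of_transpose_eq {n : ℕ} {M : Matrix (Fin n) (Fin n) ℝ} (hM : Mᵀ = M) :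
    (symPart n M : Matrix (Fin n) (Fin n) ℝ) = M := by
  show (2⁻¹ : ℝ) • (M + Mᵀ) = M
  rw [hM, ← two_smul ℝ M, smul_smul]
  norm_num

section smoothness

variable {E : Type*} [NormedAddCommGroup E] [NormedSpace ℝ E] {s : Set E} {l m k n : ℕ}

theorem contDiffOn_matrix_mul {f : E → Matrix (Fin l) (Fin m) ℝ}
    {g : E → Matrix (Fin m) (Fin k) ℝ} (hf : ContDiffOn ℝ ∞ f s) (hg : ContDiffOn ℝ ∞ g s) :
    ContDiffOn ℝ ∞ (fun x => f x * g x) s :=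
  (mulL l m k).isBoundedBilinearMap.contDiff.comp_contDiffOn (hf.prodMk hg)

theorem contDiffOn_matrix_transpose {f : E → Matrix (Fin l) (Fin m) ℝ}
    (hf : ContDiffOn ℝ ∞ f s) : ContDiffOn ℝ ∞ (fun x => (f x)ᵀ) s :=
  (transposeL l m).contDiff.comp_contDiffOn hf

theorem contDiffOn_matrix_entry {f : E → Matrix (Fin l) (Fin m) ℝ}
    (hf : ContDiffOn ℝ ∞ f s) (i : Fin l) (j : Fin m) : ContDiffOn ℝ ∞ (fun x => f x i j) s :=
  contDiffOn_pi.1 (contDiffOn_pi.1 hf i) j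

theorem contDiffOn_matrix_of_entry {f : E → Matrix (Fin l) (Fin m) ℝ}
    (hf : ∀ i j, ContDiffOn ℝ ∞ (fun x => f x i j) s) : ContDiffOn ℝ ∞ f s :=
  contDiffOn_pi.2 fun i => contDiffOn_pi.2 fun j => hf i j

theorem contDiffOn_matrix_det {f : E → Matrix (Fin n) (Fin n) ℝ} (hf : ContDiffOn ℝ ∞ f s) :
    ContDiffOn ℝ ∞ (fun x => (f x).det) s := by
  simp only [Matrix.det_apply']
  exact ContDiffOn.sum fun σ _ => contDiffOn_const.mul
    (contDiffOn_prod fun i _ => contDiffOn_matrix_entry hf _ _)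

theorem contDiffOn_matrix_inv {f : E → Matrix (Fin n) (Fin n) ℝ} (hf : ContDiffOn ℝ ∞ f s)
    (hdet : ∀ x ∈ s, (f x).det ≠ 0) : ContDiffOn ℝ ∞ (fun x => (f x)⁻¹) s := by
  have hadj : ContDiffOn ℝ ∞ (fun x => (f x).adjugate) s := by
    refine contDiffOn_matrix_of_entry fun i j => ?_
    simp only [Matrix.adjugate_apply]
    refine contDiffOn_matrix_det (contDiffOn_matrix_of_entry fun a b => ?_)
    by_cases ha : a = j
    · subst ha
      simpa using contDiffOn_const
    · simpa [Matrix.updateRow_ne ha] using contDiffOn_matrix_entry hf a b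
  refine (((contDiffOn_matrix_det hf).inv hdet).smul hadj).congr fun x hx => ?_
  rw [Matrix.inv_def, Ring.inverse_eq_inv']
  rfl

end smoothness

theorem hasFDerivAt_matrix_mul {E : Type*} [NormedAddCommGroup E] [NormedSpace ℝ E]
    {l m k : ℕ} {f : E → Matrix (Fin l) (Fin m) ℝ} {g : E → Matrix (Fin m) (Fin k) ℝ}
    {f' : E →L[ℝ] Matrix (Fin l) (Fin m) ℝ} {g' : E →L[ℝ] Matrix (Fin m) (Fin k) ℝ} {x : E}
    (hf : HasFDerivAt f f' x) (hg : HasFDerivAt g g' x) :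
    ∃ L : E →L[ℝ] Matrix (Fin l) (Fin k) ℝ, HasFDerivAt (fun y => f y * g y) L x ∧
      ∀ v, L v = f x * g' v + f' v * g x :=
  ⟨_, (mulL l m k).hasFDerivAt_of_bilinear hf hg, fun _ => rfl⟩

/-! ### Square roots and the polar decomposition near the orthogonal group -/

/-- A smooth square root on a neighbourhood of `1` in the symmetric matrices. -/
theorem exists_sym_sqrt (n : ℕ) : ∃ (W : Set (Sym n)) (h : Sym n → Sym n), IsOpen W ∧
    (0 : Sym n) ∈ W ∧ ContDiffOn ℝ ∞ h W ∧ h 0 = 0 ∧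
    ∀ Y ∈ W, (1 + (h Y : Matrix (Fin n) (Fin n) ℝ)) * (1 + (h Y).1) = 1 + (2 : ℝ) • Y.1 := by
  let ι : Sym n →L[ℝ] Matrix (Fin n) (Fin n) ℝ := (Sym n).subtypeL
  -- (1 + X)² = 1 + 2 (X + X²/2), so the square root is the local inverse of this map, whose
  -- derivative at 0 is the identity.
  let ψ : Sym n → Sym n := fun X => X + (2⁻¹ : ℝ) • symPart n (ι X * ι X)
  have hψ : ContDiffOn ℝ ∞ ψ Set.univ :=
    contDiffOn_id.add (((symPart n).contDiff.comp_contDiffOn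
      (contDiffOn_matrix_mul ι.contDiff.contDiffOn ι.contDiff.contDiffOn)).const_smul _)
  have hψd : HasFDerivAt ψ (ContinuousLinearMap.id ℝ (Sym n)) 0 := by
    obtain ⟨L, hL, hLv⟩ := hasFDerivAt_matrix_mul (ι.hasFDerivAt (x := 0)) ι.hasFDerivAt
    have := (hasFDerivAt_id (0 : Sym n)).add
      (((symPart n).hasFDerivAt.comp (0 : Sym n) hL).const_smul (2⁻¹ : ℝ))
    refine this.congr_fderiv ?_
    ext1 v
    have hv : L v = 0 := by rw [hLv, map_zero, Matrix.zero_mul, Matrix.mul_zero, add_zero]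
    show v + (2⁻¹ : ℝ) • symPart n (L v) = v
    rw [hv, map_zero, smul_zero, add_zero]
  obtain ⟨φ, hφ, h0, -, hs⟩ := exists_local_diffeo isOpen_univ hψ (Set.mem_univ 0) hψd
  have hψ0 : φ 0 = 0 := by
    rw [hφ]
    simp [ψ]
  refine ⟨φ.target, φ.symm, φ.open_target, ?_, hs, ?_, fun Y hY => ?_⟩
  · rw [← hψ0]
    exact φ.map_source h0
  · conv_lhs => rw [← hψ0]
    exact φ.left_inv h0
  · have h1 : ψ (φ.symm Y) = Y := by
      rw [← hφ]
      exact φ.right_inv hY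
    set X := φ.symm Y
    have hX : X.1ᵀ = X.1 := X.2
    have h2 : X.1 + (2⁻¹ : ℝ) • (X.1 * X.1) = Y.1 := by
      rw [← h1]
      show _ = X.1 + (2⁻¹ : ℝ) • (symPart n (X.1 * X.1)).1
      rw [symPart_of_transpose_eq (by rw [Matrix.transpose_mul, hX])]
    rw [← h2, smul_add, smul_smul, add_mul, mul_add, mul_add, one_mul, mul_one, one_mul,
      two_smul, mul_inv_cancel₀ two_ne_zero, one_smul]
    abel

/-- The orthogonal factor of the polar decomposition, near the orthogonal group. -/
theorem exists_polar (n : ℕ) : ∃ (G : Set (Matrix (Fin n) (Fin n) ℝ))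
    (pol : Matrix (Fin n) (Fin n) ℝ → Matrix (Fin n) (Fin n) ℝ), IsOpen G ∧ 1 ∈ G ∧
    (∀ U : O n, ∀ M ∈ G, U.1 * M ∈ G) ∧ ContDiffOn ℝ ∞ pol G ∧ pol 1 = 1 ∧
    (∀ M ∈ G, (pol M)ᵀ * pol M = 1) ∧ (∀ U : O n, ∀ M ∈ G, pol (U.1 * M) = U.1 * pol M) ∧
    ∀ Z : Matrix (Fin n) (Fin n) ℝ, Zᵀ = -Z → fderiv ℝ pol 1 Z = Z := by
  obtain ⟨W, h, hW, hW0, hh, hh0, hsq⟩ := exists_sym_sqrt n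
  let ι : Sym n →L[ℝ] Matrix (Fin n) (Fin n) ℝ := (Sym n).subtypeL
  let y : Matrix (Fin n) (Fin n) ℝ → Sym n := fun M => (2⁻¹ : ℝ) • symPart n (Mᵀ * M - 1)
  have hy : ContDiffOn ℝ ∞ y Set.univ :=
    ((symPart n).contDiff.comp_contDiffOn ((contDiffOn_matrix_mul
      (contDiffOn_matrix_transpose contDiffOn_id) contDiffOn_id).sub
        contDiffOn_const)).const_smul _
  have hyM : ∀ M, 1 + (2 : ℝ) • (y M).1 = Mᵀ * M := by
    intro M
    show 1 + (2 : ℝ) • (2⁻¹ : ℝ) • (symPart n (Mᵀ * M - 1)).1 = Mᵀ * M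
    rw [symPart_of_transpose_eq (by simp [Matrix.transpose_mul]), smul_smul]
    norm_num
  have hyU : ∀ (U : O n) M, y (U.1 * M) = y M := by
    intro U M
    simp only [y, Matrix.transpose_mul]
    rw [Matrix.mul_assoc, ← Matrix.mul_assoc U.1ᵀ, O_transpose_mul, Matrix.one_mul]
  let S : Matrix (Fin n) (Fin n) ℝ → Matrix (Fin n) (Fin n) ℝ := fun M => 1 + ι (h (y M))
  let G : Set (Matrix (Fin n) (Fin n) ℝ) := {M | M.det ≠ 0} ∩ y ⁻¹' W
  have hG : IsOpen G := by
    refine IsOpen.inter ?_ (hW.preimage (contDiffOn_univ.1 hy).continuous)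
    exact isOpen_ne_fun (Continuous.matrix_det continuous_id) continuous_const
  have hy1 : y 1 = 0 := by simp [y]
  have h1G : (1 : Matrix (Fin n) (Fin n) ℝ) ∈ G := ⟨by simp, by simpa [hy1] using hW0⟩
  have hSS : ∀ M ∈ G, S M * S M = Mᵀ * M := fun M hM => (hsq _ hM.2).trans (hyM M)
  have hSdet : ∀ M ∈ G, (S M).det ≠ 0 := by
    intro M hM h0
    have := congrArg Matrix.det (hSS M hM)
    rw [Matrix.det_mul, Matrix.det_mul, Matrix.det_transpose, h0] at this
    exact hM.1 (by simpa using this.symm)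
  have hSsymm : ∀ M, (S M)ᵀ = S M := by
    intro M
    have : (ι (h (y M)))ᵀ = ι (h (y M)) := (h (y M)).2
    simp [S, this]
  have hhy : ContDiffOn ℝ ∞ (fun M => h (y M)) G :=
    hh.comp (hy.mono (Set.subset_univ _)) fun M hM => hM.2
  have hS : ContDiffOn ℝ ∞ S G := contDiffOn_const.add (ι.contDiff.comp_contDiffOn hhy)
  -- `S M` is a square root of MᵀM, so this is M (MᵀM)^(-1/2). Replacing M by UM leaves MᵀM
  -- unchanged, whence the equivariance.
  let pol : Matrix (Fin n) (Fin n) ℝ → Matrix (Fin n) (Fin n) ℝ := fun M => M * (S M)⁻¹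
  have hpol : ContDiffOn ℝ ∞ pol G :=
    contDiffOn_matrix_mul contDiffOn_id (contDiffOn_matrix_inv hS hSdet)
  have hpolS : ∀ M ∈ G, pol M * S M = M := fun M hM => by
    simp only [pol]
    rw [Matrix.mul_assoc, Matrix.nonsing_inv_mul _ (isUnit_iff_ne_zero.2 (hSdet M hM)),
      Matrix.mul_one]
  have hpol1 : pol 1 = 1 := by simp [pol, S, hy1, hh0]
  have hS1 : S 1 = 1 := by simp [S, hy1, hh0]
  have horth : ∀ M ∈ G, (pol M)ᵀ * pol M = 1 := by
    intro M hM
    have hu := isUnit_iff_ne_zero.2 (hSdet M hM)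
    simp only [pol]
    rw [Matrix.transpose_mul, Matrix.transpose_nonsing_inv, hSsymm, Matrix.mul_assoc,
      ← Matrix.mul_assoc Mᵀ, ← hSS M hM, Matrix.mul_assoc (S M), Matrix.mul_nonsing_inv _ hu,
      Matrix.mul_one, Matrix.nonsing_inv_mul _ hu]
  refine ⟨G, pol, hG, h1G, fun U M hM => ⟨?_, ?_⟩, hpol, hpol1, horth, fun U M hM => ?_,
    fun Z hZ => ?_⟩
  · have hU : U.1.det ≠ 0 := fun h0 => by
      have := congrArg Matrix.det (O_transpose_mul U)
      simp [Matrix.det_mul, h0] at this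
    simpa [Matrix.det_mul, hU] using hM.1
  · rw [Set.mem_preimage, hyU]
    exact hM.2
  · simp only [pol, S, hyU, Matrix.mul_assoc]
  · have hp : HasFDerivAt pol (fderiv ℝ pol 1) 1 :=
      ((hpol.contDiffAt (hG.mem_nhds h1G)).differentiableAt (by simp)).hasFDerivAt
    have hhy' : HasFDerivAt (fun M => h (y M)) (fderiv ℝ (fun M => h (y M)) 1) 1 :=
      ((hhy.contDiffAt (hG.mem_nhds h1G)).differentiableAt (by simp)).hasFDerivAt
    have hS' : HasFDerivAt S (ι.comp (fderiv ℝ (fun M => h (y M)) 1)) 1 :=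
      (ι.hasFDerivAt.comp _ hhy').const_add 1
    obtain ⟨L₁, hL₁, hL₁v⟩ := hasFDerivAt_matrix_mul hp hS'
    obtain ⟨L₂, hL₂, hL₂v⟩ :=
      hasFDerivAt_matrix_mul ((transposeL n n).hasFDerivAt.comp _ hp) hp
    have e1 := hL₁.unique ((hasFDerivAt_id _).congr_of_eventuallyEq
      (Filter.eventuallyEq_of_mem (hG.mem_nhds h1G) hpolS))
    have e2 := hL₂.unique
      ((hasFDerivAt_const (1 : Matrix (Fin n) (Fin n) ℝ) _).congr_of_eventuallyEq
        (Filter.eventuallyEq_of_mem (hG.mem_nhds h1G) horth))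
    -- Differentiating pol · S = M gives s' + p' = Z, and differentiating orthogonality makes p'
    -- skew. Hence s' = Z - p' is both symmetric and skew, so it vanishes.
    set p' := fderiv ℝ pol 1 Z with hp'
    set s' := fderiv ℝ (fun M => h (y M)) 1 Z
    have f1 : ι s' + p' = Z := by
      have h1 : pol 1 * ι s' + p' * S 1 = Z :=
        (hL₁v Z).symm.trans (DFunLike.congr_fun e1 Z)
      rwa [hpol1, hS1, Matrix.one_mul, Matrix.mul_one] at h1
    have f2 : p' + p'ᵀ = 0 := by
      have h1 : (pol 1)ᵀ * p' + p'ᵀ * pol 1 = 0 :=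
        (hL₂v Z).symm.trans (DFunLike.congr_fun e2 Z)
      rwa [hpol1, Matrix.transpose_one, Matrix.one_mul, Matrix.mul_one] at h1
    have hs' : (ι s')ᵀ = ι s' := s'.2
    have g1 : ι s' = Z - p' := eq_sub_of_add_eq f1
    have f3 : ι s' = -ι s' := by
      have g2 : p'ᵀ = -p' := (neg_eq_of_add_eq_zero_right f2).symm
      conv_lhs => rw [← hs', g1, Matrix.transpose_sub, hZ, g2]
      rw [g1]
      abel
    have f4 : ι s' = 0 := by
      ext i j
      have := congrFun (congrFun f3 i) j
      rw [Matrix.neg_apply] at this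
      exact self_eq_neg.1 this
    rwa [f4, zero_add] at f1

/-! ### The action extended to all matrices, and its derivative -/

/-- The component `A` as a continuous linear map. -/
def compA (n m p : ℕ) : Triple n m p →L[ℝ] Sym n :=
  ContinuousLinearMap.fst ℝ (Sym n) (Matrix (Fin n) (Fin m) ℝ × Matrix (Fin p) (Fin n) ℝ)

/-- The component `B` as a continuous linear map. -/
def compB (n m p : ℕ) : Triple n m p →L[ℝ] Matrix (Fin n) (Fin m) ℝ :=
  (ContinuousLinearMap.fst ℝ (Matrix (Fin n) (Fin m) ℝ) (Matrix (Fin p) (Fin n) ℝ)).comp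
    (ContinuousLinearMap.snd ℝ (Sym n) (Matrix (Fin n) (Fin m) ℝ × Matrix (Fin p) (Fin n) ℝ))

/-- The component `C` as a continuous linear map. -/
def compC (n m p : ℕ) : Triple n m p →L[ℝ] Matrix (Fin p) (Fin n) ℝ :=
  (ContinuousLinearMap.snd ℝ (Matrix (Fin n) (Fin m) ℝ) (Matrix (Fin p) (Fin n) ℝ)).comp
    (ContinuousLinearMap.snd ℝ (Sym n) (Matrix (Fin n) (Fin m) ℝ × Matrix (Fin p) (Fin n) ℝ))

theorem contDiffOn_triple_mk {E : Type*} [NormedAddCommGroup E] [NormedSpace ℝ E] {s : Set E}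
    {n m p : ℕ} {a : E → Sym n} {b : E → Matrix (Fin n) (Fin m) ℝ}
    {c : E → Matrix (Fin p) (Fin n) ℝ} (ha : ContDiffOn ℝ ∞ a s) (hb : ContDiffOn ℝ ∞ b s)
    (hc : ContDiffOn ℝ ∞ c s) :
    ContDiffOn ℝ ∞ (fun x => ((a x, b x, c x) : Triple n m p)) s :=
  ha.prodMk (hb.prodMk hc)

/-- The extension of the action of `O(n)` to all matrices. -/
def matAct {n m p : ℕ} (M : Matrix (Fin n) (Fin n) ℝ) (Θ : Triple n m p) : Triple n m p :=
  (symPart n (Mᵀ * Θ.1.1 * M), Mᵀ * Θ.2.1, Θ.2.2 * M)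

/-- MᵀAM is symmetric whenever A is, so `symPart` only places the product in `Sym n`. This permits
differentiating in U inside the vector space of all matrices. -/
theorem matAct_coe {n m p : ℕ} (U : O n) (Θ : Triple n m p) : matAct U.1 Θ = act U Θ :=
  Prod.ext (Subtype.ext (symPart_of_transpose_eq (act U Θ).1.2)) rfl

theorem contDiffOn_matAct {E : Type*} [NormedAddCommGroup E] [NormedSpace ℝ E] {s : Set E}
    {n m p : ℕ} {M : E → Matrix (Fin n) (Fin n) ℝ} {f : E → Triple n m p}
    (hM : ContDiffOn ℝ ∞ M s) (hf : ContDiffOn ℝ ∞ f s) :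
    ContDiffOn ℝ ∞ (fun x => matAct (M x) (f x)) s := by
  have hMt := contDiffOn_matrix_transpose hM
  refine contDiffOn_triple_mk ((symPart n).contDiff.comp_contDiffOn
    (contDiffOn_matrix_mul (contDiffOn_matrix_mul hMt ?_) hM))
    (contDiffOn_matrix_mul hMt ?_) (contDiffOn_matrix_mul ?_ hM)
  · exact ((Sym n).subtypeL.comp (compA n m p)).contDiff.comp_contDiffOn hf
  · exact (compB n m p).contDiff.comp_contDiffOn hf
  · exact (compC n m p).contDiff.comp_contDiffOn hf

theorem contDiff_act {n m p : ℕ} (U : O n) :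
    ContDiff ℝ ∞ (act U : Triple n m p → Triple n m p) := by
  rw [← contDiffOn_univ]
  exact (contDiffOn_matAct contDiffOn_const contDiffOn_id).congr fun Θ _ =>
    (matAct_coe U Θ).symm

/-- The derivative of `M ↦ matAct M Θ` at `M = 1`. -/
def infAct {n m p : ℕ} (Θ : Triple n m p) : Matrix (Fin n) (Fin n) ℝ →L[ℝ] Triple n m p :=
  LinearMap.toContinuousLinearMap
    { toFun := fun X => (symPart n (Xᵀ * Θ.1.1 + Θ.1.1 * X), Xᵀ * Θ.2.1, Θ.2.2 * X)
      map_add' := fun X Y => by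
        refine Prod.ext ?_ (Prod.ext ?_ ?_)
        · refine Eq.trans ?_ (map_add (symPart n) _ _)
          rw [Matrix.transpose_add, Matrix.add_mul, Matrix.mul_add]
          abel_nf
        · show (X + Y)ᵀ * Θ.2.1 = Xᵀ * Θ.2.1 + Yᵀ * Θ.2.1
          rw [Matrix.transpose_add, Matrix.add_mul]
        · exact Matrix.mul_add _ _ _
      map_smul' := fun c X => by
        refine Prod.ext ?_ (Prod.ext ?_ ?_)
        · refine Eq.trans ?_ (map_smul (symPart n) _ _)
          rw [Matrix.transpose_smul, Matrix.smul_mul, Matrix.mul_smul, smul_add]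
          rfl
        · show (c • X)ᵀ * Θ.2.1 = c • (Xᵀ * Θ.2.1)
          rw [Matrix.transpose_smul, Matrix.smul_mul]
        · exact Matrix.mul_smul _ _ _ }

theorem hasFDerivAt_matAct {E : Type*} [NormedAddCommGroup E] [NormedSpace ℝ E] {n m p : ℕ}
    {M : E → Matrix (Fin n) (Fin n) ℝ} {f : E → Triple n m p} {x : E}
    {M' : E →L[ℝ] Matrix (Fin n) (Fin n) ℝ} {f' : E →L[ℝ] Triple n m p}
    (hM : HasFDerivAt M M' x) (hf : HasFDerivAt f f' x) (hM1 : M x = 1) :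
    ∃ L : E →L[ℝ] Triple n m p, HasFDerivAt (fun y => matAct (M y) (f y)) L x ∧
      ∀ v, L v = f' v + infAct (f x) (M' v) := by
  have hMt : HasFDerivAt (fun y => (M y)ᵀ) ((transposeL n n).comp M') x :=
    (transposeL n n).hasFDerivAt.comp x hM
  obtain ⟨L₁, h₁, hv₁⟩ := hasFDerivAt_matrix_mul hMt
    (((Sym n).subtypeL.comp (compA n m p)).hasFDerivAt.comp x hf)
  obtain ⟨L₂, h₂, hv₂⟩ := hasFDerivAt_matrix_mul h₁ hM
  obtain ⟨L₃, h₃, hv₃⟩ := hasFDerivAt_matrix_mul hMt ((compB n m p).hasFDerivAt.comp x hf)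
  obtain ⟨L₄, h₄, hv₄⟩ := hasFDerivAt_matrix_mul ((compC n m p).hasFDerivAt.comp x hf) hM
  refine ⟨_, ((symPart n).hasFDerivAt.comp x h₂).prodMk (h₃.prodMk h₄), fun v => ?_⟩
  have e₂ : L₂ v = (f' v).1.1 + ((M' v)ᵀ * (f x).1.1 + (f x).1.1 * M' v) := by
    have := hv₂ v
    rw [hv₁ v] at this
    refine this.trans ?_
    show (M x)ᵀ * (f x).1.1 * M' v + ((M x)ᵀ * (f' v).1.1 + (M' v)ᵀ * (f x).1.1) * M x = _
    rw [hM1, Matrix.transpose_one, Matrix.one_mul, Matrix.one_mul, Matrix.mul_one]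
    abel
  have e₃ : L₃ v = (f' v).2.1 + (M' v)ᵀ * (f x).2.1 := by
    refine (hv₃ v).trans ?_
    show (M x)ᵀ * (f' v).2.1 + (M' v)ᵀ * (f x).2.1 = _
    rw [hM1, Matrix.transpose_one, Matrix.one_mul]
  have e₄ : L₄ v = (f' v).2.2 + (f x).2.2 * M' v := by
    refine (hv₄ v).trans ?_
    show (f x).2.2 * M' v + (f' v).2.2 * M x = _
    rw [hM1, Matrix.mul_one, add_comm]
  refine Prod.ext ?_ (Prod.ext e₃ e₄)
  show symPart n (L₂ v) = (f' v).1 + symPart n ((M' v)ᵀ * (f x).1.1 + (f x).1.1 * M' v)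
  rw [e₂, map_add]
  congr 1
  exact Subtype.ext (symPart_of_transpose_eq (f' v).1.2)

/-! ### Reachable frames and the invariant retraction -/

theorem contDiff_state {n m p : ℕ} (u : ℕ → Fin m → ℝ) (k : ℕ) :
    ContDiff ℝ ∞ fun Θ : Triple n m p => state Θ.1.1 Θ.2.1 0 u k := by
  have hA : ∀ i j, ContDiff ℝ ∞ fun Θ : Triple n m p => Θ.1.1 i j := fun i j =>
    contDiffOn_univ.1 (contDiffOn_matrix_entry
      ((Sym n).subtypeL.comp (compA n m p)).contDiff.contDiffOn i j)
  have hB : ∀ i j, ContDiff ℝ ∞ fun Θ : Triple n m p => Θ.2.1 i j := fun i j =>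
    contDiffOn_univ.1 (contDiffOn_matrix_entry (compB n m p).contDiff.contDiffOn i j)
  induction k with
  | zero => exact contDiff_const
  | succ k ih =>
    refine contDiff_pi.2 fun i => ?_
    simp only [state, Pi.add_apply, Matrix.mulVec, dotProduct]
    exact (ContDiff.sum fun j _ => (hA i j).mul (contDiff_pi.1 ih j)).add
      (ContDiff.sum fun j _ => (hB i j).mul contDiff_const)

/-- Near a controllable system, reachable states form a frame that moves with the action. -/
theorem exists_frame {n m p : ℕ} (Θ₀ : Triple n m p) (h : IsControllable Θ₀.1.1 Θ₀.2.1) :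
    ∃ R : Triple n m p → Matrix (Fin n) (Fin n) ℝ, ContDiff ℝ ∞ R ∧ R Θ₀ = 1 ∧
      ∀ (U : O n) Θ, R (act U Θ) = U.1ᵀ * R Θ := by
  choose v S hv using fun i : Fin n => h 0 (Pi.single i 1)
  set T : ℕ := ∑ i, S i with hT
  have hST : ∀ i, S i ≤ T := fun i => Finset.single_le_sum (fun _ _ => Nat.zero_le _)
    (Finset.mem_univ i)
  -- Zero input keeps the state at 0, so padding with initial zeros makes all basis vectors reached
  -- at one common time `T`.
  set w : Fin n → ℕ → Fin m → ℝ :=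
    fun i j => if j < T - S i then 0 else v i (j - (T - S i)) with hw
  have hwT : ∀ i, state Θ₀.1.1 Θ₀.2.1 0 (w i) T = Pi.single i 1 := by
    intro i
    have := state_delay Θ₀.1.1 Θ₀.2.1 (v i) (T - S i) (S i)
    rw [Nat.sub_add_cancel (hST i), hv i] at this
    exact this
  refine ⟨fun Θ => Matrix.of fun a i => state Θ.1.1 Θ.2.1 0 (w i) T a, ?_, ?_, ?_⟩
  · exact contDiffOn_univ.1 (contDiffOn_matrix_of_entry fun a i =>
      (contDiff_pi.1 (contDiff_state (w i) T) a).contDiffOn)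
  · ext a b
    simp [hwT, Matrix.one_apply, Pi.single_apply]
  · intro U Θ
    ext a b
    simp only [Matrix.of_apply]
    rw [state_act, Matrix.mulVec_zero]
    rfl

/-- The skew-symmetric matrices. -/
def Skew (n : ℕ) : Submodule ℝ (Matrix (Fin n) (Fin n) ℝ) where
  carrier := {X | Xᵀ = -X}
  add_mem' {X Y} hX hY := by
    show (X + Y)ᵀ = -(X + Y)
    rw [Matrix.transpose_add, hX, hY, neg_add]
  zero_mem' := by
    show (0 : Matrix (Fin n) (Fin n) ℝ)ᵀ = -0
    simp
  smul_mem' c X hX := by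
    show (c • X)ᵀ = -(c • X)
    rw [Matrix.transpose_smul, hX, smul_neg]

/-- Near every system there is a smooth invariant retraction that maps each system to an
equivalent one. -/
theorem exists_invariant_retraction {n m p : ℕ} {Θ₀ : Triple n m p} (h₀ : Θ₀ ∈ carrierN n m p) :
    ∃ (D : Set (Triple n m p)) (r : Triple n m p → Triple n m p), IsOpen D ∧
      D ⊆ carrierN n m p ∧ Θ₀ ∈ D ∧ ContDiffOn ℝ ∞ r D ∧ (∀ (U : O n), ∀ Θ ∈ D, act U Θ ∈ D) ∧
      (∀ (U : O n), ∀ Θ ∈ D, r (act U Θ) = r Θ) ∧ (∀ Θ ∈ D, ∃ U : O n, r Θ = act U Θ) ∧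
      r Θ₀ = Θ₀ ∧ Module.finrank ℝ (fderiv ℝ r Θ₀).range + Module.finrank ℝ (Skew n) =
        Module.finrank ℝ (Triple n m p) := by
  obtain ⟨R, hR, hR0, hRU⟩ := exists_frame Θ₀ h₀.2.1
  obtain ⟨G, pol, hG, h1G, hUG, hpol, hpol1, horth, hpolU, hskew⟩ := exists_polar n
  let D : Set (Triple n m p) := carrierN n m p ∩ R ⁻¹' G
  have hD : IsOpen D := (isOpen_carrierN n m p).inter (hG.preimage hR.continuous)
  have h0D : Θ₀ ∈ D := ⟨h₀, by
    rw [Set.mem_preimage, hR0]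
    exact h1G⟩
  -- ρ(U ∘ Θ) = Uᵀ ρ(Θ), so acting by ρ(Θ) cancels the position of Θ in its orbit.
  let ρ : Triple n m p → Matrix (Fin n) (Fin n) ℝ := fun Θ => pol (R Θ)
  have hρ : ContDiffOn ℝ ∞ ρ D := hpol.comp hR.contDiffOn fun Θ hΘ => hΘ.2
  have hρ0 : ρ Θ₀ = 1 := by simp [ρ, hR0, hpol1]
  have hρO : ∀ Θ ∈ D, (ρ Θ)ᵀ * ρ Θ = 1 := fun Θ hΘ => horth _ hΘ.2
  have hinv : ∀ U : O n, (U⁻¹).1 = U.1ᵀ := fun U => rfl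
  have hactD : ∀ (U : O n), ∀ Θ ∈ D, act U Θ ∈ D := by
    intro U Θ hΘ
    refine ⟨act_mem U hΘ.1, ?_⟩
    rw [Set.mem_preimage, hRU, ← hinv]
    exact hUG _ _ hΘ.2
  have hρU : ∀ (U : O n), ∀ Θ ∈ D, ρ (act U Θ) = U.1ᵀ * ρ Θ := by
    intro U Θ hΘ
    simp only [ρ]
    rw [hRU, ← hinv, hpolU _ _ hΘ.2]
  let u : ∀ M : Matrix (Fin n) (Fin n) ℝ, Mᵀ * M = 1 → O n := fun M hM =>
    ⟨M, (Matrix.mem_orthogonalGroup_iff' _ _).2 hM⟩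
  let r : Triple n m p → Triple n m p := fun Θ => matAct (ρ Θ) Θ
  have hrD : ∀ Θ (hΘ : Θ ∈ D), r Θ = act (u _ (hρO Θ hΘ)) Θ := fun Θ hΘ =>
    matAct_coe (u _ (hρO Θ hΘ)) Θ
  have hρd : HasFDerivAt ρ (fderiv ℝ ρ Θ₀) Θ₀ :=
    ((hρ.contDiffAt (hD.mem_nhds h0D)).differentiableAt (by simp)).hasFDerivAt
  set ρ' := fderiv ℝ ρ Θ₀ with hρ'
  have hρskew : ∀ v, (ρ' v)ᵀ = -ρ' v := by
    intro v
    obtain ⟨L, hL, hLv⟩ :=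
      hasFDerivAt_matrix_mul ((transposeL n n).hasFDerivAt.comp _ hρd) hρd
    have e := hL.unique ((hasFDerivAt_const (1 : Matrix (Fin n) (Fin n) ℝ) _).congr_of_eventuallyEq
        (Filter.eventuallyEq_of_mem (hD.mem_nhds h0D) hρO))
    have h1 : (ρ Θ₀)ᵀ * ρ' v + (ρ' v)ᵀ * ρ Θ₀ = 0 :=
      (hLv v).symm.trans (DFunLike.congr_fun e v)
    rw [hρ0, Matrix.transpose_one, Matrix.one_mul, Matrix.mul_one] at h1
    exact (neg_eq_of_add_eq_zero_right h1).symm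
  have hρinf : ∀ X : Matrix (Fin n) (Fin n) ℝ, Xᵀ = -X → ρ' (infAct Θ₀ X) = -X := by
    intro X hX
    have hp : HasFDerivAt pol (fderiv ℝ pol 1) 1 :=
      ((hpol.contDiffAt (hG.mem_nhds h1G)).differentiableAt (by simp)).hasFDerivAt
    obtain ⟨L, hL, hLv⟩ := hasFDerivAt_matAct hp (hasFDerivAt_const Θ₀ _) hpol1
    have h1 : matAct (pol 1) Θ₀ = Θ₀ := by
      rw [hpol1]
      exact (matAct_coe 1 Θ₀).trans (act_one Θ₀)
    have hc := HasFDerivAt.comp (g := ρ) (g' := ρ') 1 (by rwa [h1]) hL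
    -- Composing with `pol` keeps the acting matrix orthogonal for all M near 1, so equivariance of
    -- `ρ` applies. On a skew X, where `pol` has derivative X, the two sides differentiate to
    -- ρ'(infAct X) and Xᵀ = -X.
    have he : ρ ∘ (fun M => matAct (pol M) Θ₀) =ᶠ[𝓝 1] fun M => (pol M)ᵀ := by
      filter_upwards [hG.mem_nhds h1G] with M hM
      have := hρU (u _ (horth M hM)) Θ₀ h0D
      rw [← matAct_coe, hρ0, Matrix.mul_one] at this
      exact this
    have := DFunLike.congr_fun (hc.unique
      (((transposeL n n).hasFDerivAt.comp _ hp).congr_of_eventuallyEq he)) X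
    have h2 : ρ' (L X) = (fderiv ℝ pol 1 X)ᵀ := this
    have h3 : L X = infAct Θ₀ X :=
      (hLv X).trans ((zero_add _).trans (congrArg (infAct Θ₀) (hskew X hX)))
    rw [← h3, h2, hskew X hX, hX]
  have hr0 : r Θ₀ = Θ₀ := by
    simp only [r, hρ0]
    exact (matAct_coe 1 Θ₀).trans (act_one Θ₀)
  refine ⟨D, r, hD, fun Θ hΘ => hΘ.1, h0D, contDiffOn_matAct hρ contDiffOn_id, hactD, ?_,
    fun Θ hΘ => ⟨_, hrD Θ hΘ⟩, hr0, ?_⟩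
  · intro U Θ hΘ
    rw [hrD _ (hactD U Θ hΘ), hrD _ hΘ, act_act]
    congr 1
    refine Subtype.ext ?_
    show U.1 * ρ (act U Θ) = ρ Θ
    rw [hρU U Θ hΘ, ← Matrix.mul_assoc, O_mul_transpose, Matrix.one_mul]
  · obtain ⟨P, hP, hPv⟩ := hasFDerivAt_matAct hρd (hasFDerivAt_id Θ₀) hρ0
    have hPv' : ∀ v, P v = v + infAct Θ₀ (ρ' v) := hPv
    rw [show fderiv ℝ r Θ₀ = P from hP.fderiv]
    -- As P v = v + infAct(ρ' v), a kernel vector is determined by ρ' v, which is skew; and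
    -- ρ'(infAct X) = -X makes every skew matrix occur. This fixes the rank independently of `Θ₀`.
    let f : P.ker →ₗ[ℝ] Skew n :=
      ((ρ' : Triple n m p →ₗ[ℝ] Matrix (Fin n) (Fin n) ℝ).comp P.ker.subtype).codRestrict
        (Skew n) fun v => hρskew v
    have hf : Function.Bijective f := by
      constructor
      · rw [injective_iff_map_eq_zero]
        intro v hv
        have h1 : ρ' v = 0 := congrArg Subtype.val hv
        have h2 : P v = 0 := v.2
        rw [hPv', h1, map_zero, add_zero] at h2
        exact Subtype.ext h2
      · intro X
        have hX : (X.1)ᵀ = -X.1 := X.2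
        have h1 : ρ' (infAct Θ₀ (-X.1)) = X.1 := by
          rw [map_neg, map_neg, hρinf _ hX, neg_neg]
        refine ⟨⟨infAct Θ₀ (-X.1), ?_⟩, Subtype.ext h1⟩
        show P (infAct Θ₀ (-X.1)) = 0
        rw [hPv', h1, map_neg, neg_add_cancel]
    rw [← (LinearEquiv.ofBijective f hf).finrank_eq]
    exact (P : Triple n m p →ₗ[ℝ] Triple n m p).finrank_range_add_finrank_ker

/-! ### Topology of the orbit space -/

theorem continuous_phi {n m p : ℕ} (U : O n) : Continuous (phi U : N n m p → N n m p) :=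
  ((contDiff_act U).continuous.comp continuous_subtype_val).subtype_mk _

theorem proj_eq_iff {n m p : ℕ} {Θ Θ' : N n m p} :
    proj Θ = proj Θ' ↔ ∃ U : O n, Θ' = phi U Θ :=
  Quotient.eq

theorem proj_phi {n m p : ℕ} (U : O n) (Θ : N n m p) : proj (phi U Θ) = proj Θ :=
  (proj_eq_iff.2 ⟨U, rfl⟩).symm

/-- The saturation of an open set is the union of its preimages under the continuous maps φ_U. -/
theorem isOpenQuotientMap_proj (n m p : ℕ) :
    IsOpenQuotientMap (proj : N n m p → Orbits n m p) where
  surjective := Quotient.mk_surjective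
  continuous := continuous_quotient_mk'
  isOpenMap V hV := by
    have : (proj : N n m p → Orbits n m p) ⁻¹' (proj '' V) =
        ⋃ U : O n, (phi U : N n m p → N n m p) ⁻¹' V := by
      ext Θ
      simp only [Set.mem_preimage, Set.mem_image, Set.mem_iUnion]
      constructor
      · rintro ⟨Θ', hΘ', h⟩
        obtain ⟨U, rfl⟩ := proj_eq_iff.1 h.symm
        exact ⟨U, hΘ'⟩
      · rintro ⟨U, hU⟩
        exact ⟨_, hU, proj_phi U Θ⟩
    refine isOpen_coinduced.2 ?_
    show IsOpen ((proj : N n m p → Orbits n m p) ⁻¹' (proj '' V))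
    rw [this]
    exact isOpen_iUnion fun U => hV.preimage (continuous_phi U)

instance compactSpace_O (n : ℕ) : CompactSpace (O n) := by
  refine isCompact_iff_compactSpace.1 ?_
  refine Metric.isCompact_of_isClosed_isBounded ?_ ?_
  · have : (Matrix.orthogonalGroup (Fin n) ℝ : Set (Matrix (Fin n) (Fin n) ℝ)) =
        {M | Mᵀ * M = 1} := Set.ext fun M => Matrix.mem_orthogonalGroup_iff' _ _
    rw [this]
    exact isClosed_eq ((Continuous.matrix_transpose continuous_id).matrix_mul continuous_id)
      continuous_const
  · refine (Metric.isBounded_closedBall (x := 0) (r := 1)).subset fun M hM => ?_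
    rw [mem_closedBall_zero_iff]
    exact entrywise_sup_norm_bound_of_unitary hM

/-- For an open quotient map it suffices that the equivalence relation is closed. It is the
projection of the closed set {(U, Θ, Θ') : U ∘ Θ = Θ'} along the compact factor O(n). -/
theorem t2Space_orbits (n m p : ℕ) : T2Space (Orbits n m p) := by
  rw [t2Space_iff_of_isOpenQuotientMap (isOpenQuotientMap_proj n m p)]
  have hact : Continuous fun z : O n × (N n m p × N n m p) => act z.1 z.2.1.1 := by
    have h1 : ContDiffOn ℝ ∞ (fun z : Matrix (Fin n) (Fin n) ℝ × Triple n m p =>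
        matAct z.1 z.2) Set.univ :=
      contDiffOn_matAct contDiff_fst.contDiffOn contDiff_snd.contDiffOn
    have h2 := (contDiffOn_univ.1 h1).continuous.comp
      (f := fun z : O n × (N n m p × N n m p) => (z.1.1, z.2.1.1)) (by fun_prop)
    refine h2.congr fun z => ?_
    exact matAct_coe z.1 z.2.1.1
  have hc : IsClosed {z : O n × (N n m p × N n m p) | act z.1 z.2.1.1 = z.2.2.1} :=
    isClosed_eq hact (by fun_prop)
  have := isClosedMap_snd_of_compactSpace _ hc
  convert this using 1
  ext ⟨Θ, Θ'⟩
  simp only [Set.mem_ofPred_eq, Set.mem_image, Prod.exists, proj_eq_iff]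
  constructor
  · rintro ⟨U, rfl⟩
    exact ⟨U, Θ, _, rfl, rfl⟩
  · rintro ⟨U, Θ₁, Θ₂, h, h'⟩
    obtain ⟨rfl, rfl⟩ := Prod.mk.inj h'
    exact ⟨U, Subtype.ext h.symm⟩

theorem secondCountable_orbits (n m p : ℕ) : SecondCountableTopology (Orbits n m p) := by
  have : SecondCountableTopology (Triple n m p) := by
    have := FiniteDimensional.proper ℝ (Triple n m p)
    infer_instance
  exact (isOpenQuotientMap_proj n m p).isQuotientMap.secondCountableTopology
    (isOpenQuotientMap_proj n m p).isOpenMap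

/-! ### Slice charts and the smooth structure -/

/-- The dimension of the orbit space. -/
def orbitDim (n m p : ℕ) : ℕ := Module.finrank ℝ (Triple n m p) - Module.finrank ℝ (Skew n)

/-- `c` is a chart of the orbit space that is smooth along `π`, with a smooth section of `π` over
it through `Θ₀`. -/
def IsSliceChart {n m p : ℕ} (Θ₀ : N n m p)
    (c : OpenPartialHomeomorph (Orbits n m p) (EuclideanSpace ℝ (Fin (orbitDim n m p)))) : Prop :=
  proj Θ₀ ∈ c.source ∧
  (∃ σ : EuclideanSpace ℝ (Fin (orbitDim n m p)) → N n m p,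
    ContDiffOn ℝ ∞ (fun y => (σ y : Triple n m p)) c.target ∧
    (∀ y ∈ c.target, proj (σ y) = c.symm y) ∧ σ (c (proj Θ₀)) = Θ₀) ∧
  ∃ (V : Set (Triple n m p)) (k : Triple n m p → EuclideanSpace ℝ (Fin (orbitDim n m p))),
    IsOpen V ∧ ContDiffOn ℝ ∞ k V ∧ (∀ Θ : N n m p, proj Θ ∈ c.source ↔ Θ.1 ∈ V) ∧
    ∀ Θ : N n m p, Θ.1 ∈ V → c (proj Θ) = k Θ.1

/-- The invariant retraction picks one representative of each nearby orbit. Coordinates `k` on its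
image therefore descend to the quotient, and the parametrization `σ` of the image inverts them up to
equivalence. -/
theorem exists_isSliceChart {n m p : ℕ} (Θ₀ : N n m p) : ∃ c, IsSliceChart Θ₀ c := by
  classical
  obtain ⟨D, r, hD, hDN, h0D, hr, hactD, hrU, hrO, hr0, hdim⟩ := exists_invariant_retraction Θ₀.2
  have hrD : Set.MapsTo r D D := by
    intro Θ hΘ
    obtain ⟨U, hU⟩ := hrO Θ hΘ
    rw [hU]
    exact hactD U Θ hΘ
  have hrr : ∀ Θ ∈ D, r (r Θ) = r Θ := by
    intro Θ hΘ
    obtain ⟨U, hU⟩ := hrO Θ hΘ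
    conv_lhs => rw [hU]
    exact hrU U Θ hΘ
  let e : (fderiv ℝ r Θ₀).range ≃L[ℝ] EuclideanSpace ℝ (Fin (orbitDim n m p)) :=
    ContinuousLinearEquiv.ofFinrankEq (by
      rw [finrank_euclideanSpace_fin, orbitDim]
      omega)
  obtain ⟨V, T, k, σ, hV, hT, hVD, h0V, hVs, hVr, hk, hσ, hkT, hσV, hσk, hkσ, hkr⟩ :=
    exists_chart_of_retraction hD hr hrD hrr h0D hr0 e
  let σN : EuclideanSpace ℝ (Fin (orbitDim n m p)) → N n m p := fun y =>
    if h : σ y ∈ carrierN n m p then ⟨σ y, h⟩ else Θ₀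
  have hσN : ∀ y ∈ T, (σN y : Triple n m p) = σ y := by
    intro y hy
    simp only [σN, dif_pos (hDN (hVD (hσV hy)))]
  have hinv : ∀ Θ Θ' : N n m p, proj Θ = proj Θ' → Θ.1 ∈ V → Θ'.1 ∈ V ∧ k Θ'.1 = k Θ.1 := by
    intro Θ Θ' h hΘ
    obtain ⟨U, rfl⟩ := proj_eq_iff.1 h
    have h1 := hactD U _ (hVD hΘ)
    have h2 := hrU U _ (hVD hΘ)
    have h3 : act U Θ.1 ∈ V := hVs _ h1 (by rw [h2]; exact hVr _ hΘ)
    refine ⟨h3, ?_⟩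
    show k (act U Θ.1) = _
    rw [← hkr _ h3, h2, hkr _ hΘ]
  have hout : ∀ Θ : N n m p, proj (proj Θ).out = proj Θ := fun Θ => Quotient.out_eq _
  have hsrc : ∀ Θ : N n m p, (proj Θ).out.1 ∈ V ↔ Θ.1 ∈ V := fun Θ =>
    ⟨fun h => (hinv _ _ (hout Θ) h).1, fun h => (hinv _ _ (hout Θ).symm h).1⟩
  have hkout : ∀ Θ : N n m p, Θ.1 ∈ V → k (proj Θ).out.1 = k Θ.1 := fun Θ h =>
    (hinv _ _ (hout Θ).symm h).2
  have hopen : ∀ S : Set (Orbits n m p), IsOpen (proj ⁻¹' S) → IsOpen S := fun S h =>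
    (isOpenQuotientMap_proj n m p).isQuotientMap.isOpen_preimage.1 h
  have hkN : ∀ S, IsOpen S → IsOpen {Θ : N n m p | Θ.1 ∈ V ∧ k Θ.1 ∈ S} := fun S hS =>
    (hk.continuousOn.isOpen_inter_preimage hV hS).preimage continuous_subtype_val
  -- The representative `q.out` need not vary continuously; by `hsrc` and `hkout` neither membership
  -- in `V` nor the value of `k` depends on it.
  let c : OpenPartialHomeomorph (Orbits n m p) (EuclideanSpace ℝ (Fin (orbitDim n m p))) :=
    { toFun := fun q => k q.out.1
      invFun := fun y => proj (σN y)
      source := {q | q.out.1 ∈ V}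
      target := T
      map_source' := fun q hq => hkT hq
      map_target' := fun y hy => by
        rw [Set.mem_ofPred_eq, hsrc, hσN y hy]
        exact hσV hy
      left_inv' := by
        intro q hq
        obtain ⟨U, hU⟩ := hrO _ (hVD hq)
        have h1 : σN (k q.out.1) = phi U q.out := by
          refine Subtype.ext ?_
          rw [hσN _ (hkT hq), hσk _ hq, hU]
          rfl
        rw [h1, proj_phi]
        exact Quotient.out_eq _
      right_inv' := by
        intro y hy
        have h1 : (σN y).1 ∈ V := by
          rw [hσN y hy]
          exact hσV hy
        rw [hkout _ h1, hσN y hy, hkσ y hy]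
      open_source := hopen _ (by
        simpa [Set.preimage, hsrc] using hV.preimage continuous_subtype_val)
      open_target := hT
      continuousOn_toFun := by
        have hs : IsOpen {q : Orbits n m p | q.out.1 ∈ V} := hopen _ (by
          simpa [Set.preimage, hsrc] using hV.preimage continuous_subtype_val)
        refine (continuousOn_open_iff hs).2 fun S hS => hopen _ ?_
        convert hkN S hS using 1
        ext Θ
        simp only [Set.mem_preimage, Set.mem_inter_iff, Set.mem_ofPred_eq, hsrc]
        exact and_congr_right fun h => by rw [hkout _ h]
      continuousOn_invFun := by
        refine (isOpenQuotientMap_proj n m p).continuous.comp_continuousOn ?_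
        rw [continuousOn_iff_continuous_domRestrict, continuous_induced_rng]
        refine (continuousOn_iff_continuous_domRestrict.1 hσ.continuousOn).congr fun y => ?_
        exact (hσN y.1 y.2).symm }
  refine ⟨c, (hsrc Θ₀).2 h0V, ⟨σN, hσ.congr hσN, fun y _ => rfl, ?_⟩, V, k, hV, hk, hsrc, hkout⟩
  refine Subtype.ext ?_
  show (σN (k (proj Θ₀).out.1)).1 = _
  rw [hkout Θ₀ h0V, hσN _ (hkT h0V), hσk _ h0V, hr0]

/-- The atlas of slice charts on the orbit space. -/
@[reducible]
def orbitChartedSpace (n m p : ℕ) :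
    ChartedSpace (EuclideanSpace ℝ (Fin (orbitDim n m p))) (Orbits n m p) where
  atlas := Set.range fun Θ : N n m p => (exists_isSliceChart Θ).choose
  chartAt q := (exists_isSliceChart q.out).choose
  mem_chart_source q := by
    have := (exists_isSliceChart q.out).choose_spec.1
    rwa [show proj q.out = q from Quotient.out_eq q] at this
  chart_mem_atlas q := ⟨q.out, rfl⟩

theorem isQuotientManifold_orbits (n m p : ℕ) :
    letI := orbitChartedSpace n m p
    IsQuotientManifold n m p (orbitDim n m p) := by
  let := orbitChartedSpace n m p
  have hM : IsManifold (𝓡 (orbitDim n m p)) ∞ (Orbits n m p) := by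
    refine isManifold_of_contDiffOn _ _ _ ?_
    rintro _ _ ⟨Θ, rfl⟩ ⟨Θ', rfl⟩
    obtain ⟨-, ⟨σ, hσ, hσc, -⟩, -⟩ := (exists_isSliceChart Θ).choose_spec
    obtain ⟨-, -, V, k, hV, hk, hsrc, hkc⟩ := (exists_isSliceChart Θ').choose_spec
    dsimp only
    set c := (exists_isSliceChart Θ).choose
    set c' := (exists_isSliceChart Θ').choose
    have hmem : ∀ y ∈ (c.symm.trans c').source, y ∈ c.target ∧ (σ y).1 ∈ V := by
      intro y hy
      rw [OpenPartialHomeomorph.trans_source] at hy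
      refine ⟨hy.1, (hsrc _).1 ?_⟩
      rw [hσc y hy.1]
      exact hy.2
    -- A transition map is the section of one chart followed by the invariant coordinates of the
    -- other.
    have h1 : ContDiffOn ℝ ∞ (fun y => k (σ y).1) (c.symm.trans c').source :=
      hk.comp (hσ.mono fun y hy => (hmem y hy).1) fun y hy => (hmem y hy).2
    simp only [modelWithCornersSelf_coe, modelWithCornersSelf_coe_symm, Function.id_comp,
      Function.comp_id, Set.preimage_id, Set.range_id, Set.inter_univ]
    refine h1.congr fun y hy => ?_
    show c' (c.symm y) = _
    rw [← hσc y (hmem y hy).1, hkc _ (hmem y hy).2]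
  have hsmooth : ContMDiff 𝓘(ℝ, Triple n m p) (𝓡 (orbitDim n m p)) ∞
      (proj : N n m p → Orbits n m p) := by
    intro Θ
    rw [contMDiffAt_iff_target]
    refine ⟨(isOpenQuotientMap_proj n m p).continuous.continuousAt, ?_⟩
    obtain ⟨hs, -, V, k, hV, hk, hsrc, hkc⟩ := (exists_isSliceChart (proj Θ).out).choose_spec
    rw [show proj (proj Θ).out = proj Θ from Quotient.out_eq _, hsrc] at hs
    have h1 : ContMDiffAt 𝓘(ℝ, Triple n m p) 𝓘(ℝ, EuclideanSpace ℝ (Fin (orbitDim n m p))) ∞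
        (fun Θ' : N n m p => k Θ'.1) Θ :=
      contMDiffAt_subtype_iff.2 (hk.contDiffAt (hV.mem_nhds hs)).contMDiffAt
    refine h1.congr_of_eventuallyEq ?_
    filter_upwards [(hV.preimage continuous_subtype_val).mem_nhds hs] with Θ' hΘ'
    exact hkc Θ' hΘ'
  refine ⟨t2Space_orbits n m p, secondCountable_orbits n m p, hM, hsmooth, fun Θ => ?_⟩
  -- The slice chart built at `Θ` itself is used because its section passes through `Θ`: there π ∘ σ
  -- is the inverse chart, so Dπ(Θ) ∘ Dσ is bijective.
  obtain ⟨hs, ⟨σ, hσ, hσc, hσΘ⟩, -⟩ := (exists_isSliceChart Θ).choose_spec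
  have hat : (exists_isSliceChart Θ).choose ∈
      atlas (EuclideanSpace ℝ (Fin (orbitDim n m p))) (Orbits n m p) := ⟨Θ, rfl⟩
  set c := (exists_isSliceChart Θ).choose
  set y₀ := c (proj Θ) with hy₀
  have hy₀T : y₀ ∈ c.target := c.map_source hs
  have hσd : MDifferentiableAt (𝓡 (orbitDim n m p)) 𝓘(ℝ, Triple n m p) σ y₀ :=
    ((ContMDiffAt.subtypeVal_comp_iff (N n m p) σ y₀).1
      (hσ.contDiffAt (c.open_target.mem_nhds hy₀T)).contMDiffAt).mdifferentiableAt (by simp)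
  have hcd : c.MDifferentiable (𝓡 (orbitDim n m p)) (𝓡 (orbitDim n m p)) :=
    mdifferentiable_of_mem_atlas (I := 𝓡 (orbitDim n m p)) hat
  have hcomp : (proj ∘ σ : _ → Orbits n m p) =ᶠ[𝓝 y₀] c.symm := by
    filter_upwards [c.open_target.mem_nhds hy₀T] with y hy using hσc y hy
  have hchain := mfderiv_comp (I := 𝓡 (orbitDim n m p)) (I' := 𝓘(ℝ, Triple n m p))
    (I'' := 𝓡 (orbitDim n m p)) y₀ ((hsmooth (σ y₀)).mdifferentiableAt (by simp)) hσd
  rw [hcomp.mfderiv_eq] at hchain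
  have hsurj := (hcd.symm.mfderiv_bijective hy₀T).surjective
  rw [hchain] at hsurj
  rw [hσΘ] at hsurj
  intro w
  obtain ⟨v, hv⟩ := hsurj w
  exact ⟨_, hv⟩

/-! ### Orthogonal preimages and invariance of the metric -/

/-- A surjective linear map has, for a positive definite form, a unique section with values
orthogonal to its kernel. -/
theorem existsUnique_orthogonal_preimage {E F : Type*} [AddCommGroup E] [Module ℝ E]
    [FiniteDimensional ℝ E] [AddCommGroup F] [Module ℝ F] (b : LinearMap.BilinForm ℝ E)
    (hsymm : ∀ v w, b v w = b w v) (hpos : ∀ v, b v v = 0 → v = 0) (f : E →ₗ[ℝ] F)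
    (hf : Function.Surjective f) (ξ : F) :
    ∃! h : E, (∀ v, f v = 0 → b h v = 0) ∧ f h = ξ := by
  have hrefl : b.IsRefl := fun v w h => by rw [hsymm, h]
  -- Definiteness passes to the kernel, so the kernel and its orthogonal complement span; the lift
  -- is the orthogonal component of any preimage.
  have hnd : (b.restrict (LinearMap.ker f)).Nondegenerate :=
    ⟨fun v hv => Subtype.ext (hpos v (hv v)), fun v hv => Subtype.ext (hpos v (hv v))⟩
  have hcompl := LinearMap.BilinForm.isCompl_orthogonal_of_restrict_nondegenerate hrefl hnd
  obtain ⟨w, rfl⟩ := hf ξ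
  have hw : w ∈ LinearMap.ker f ⊔ b.orthogonal (LinearMap.ker f) := by
    rw [hcompl.sup_eq_top]
    trivial
  obtain ⟨k, hk, h, hh, rfl⟩ := Submodule.mem_sup.1 hw
  rw [LinearMap.mem_ker] at hk
  refine ⟨h, ⟨fun v hv => ?_, by rw [map_add, hk, zero_add]⟩, ?_⟩
  · rw [hsymm]
    exact hh v hv
  · rintro h' ⟨h1, h2⟩
    rw [map_add, hk, zero_add] at h2
    have hd : f (h' - h) = 0 := by rw [map_sub, h2, sub_self]
    refine sub_eq_zero.1 (hpos _ ?_)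
    rw [map_sub b, LinearMap.sub_apply, h1 _ hd, hsymm h, hh _ hd, sub_self]

/-- Writing P = QᵀQ with Q invertible, cyclicity turns the trace into the squared Frobenius norm of
Q X Qᵀ. -/
theorem trace_mul_mul_mul_self_nonneg {n : ℕ} {P X : Matrix (Fin n) (Fin n) ℝ} (hP : P.PosDef)
    (hX : Xᵀ = X) : 0 ≤ (P * X * P * X).trace ∧ ((P * X * P * X).trace = 0 → X = 0) := by
  obtain ⟨Q, rfl⟩ : ∃ Q : Matrix (Fin n) (Fin n) ℝ, P = Qᵀ * Q := by
    open scoped MatrixOrder in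
    obtain ⟨Q, hQ⟩ := CStarAlgebra.nonneg_iff_eq_star_mul_self.1 hP.posSemidef.nonneg
    exact ⟨Q, hQ⟩
  have hQ : IsUnit Q.det := by
    have := hP.det_pos.ne'
    rw [Matrix.det_mul] at this
    exact isUnit_iff_ne_zero.2 (right_ne_zero_of_mul this)
  have hY : (Q * X * Qᵀ)ᴴ = Q * X * Qᵀ := by
    rw [Matrix.conjTranspose_eq_transpose_of_trivial, Matrix.transpose_mul,
      Matrix.transpose_mul, Matrix.transpose_transpose, hX, Matrix.mul_assoc]
  have ht : (Qᵀ * Q * X * (Qᵀ * Q) * X).trace = ((Q * X * Qᵀ)ᴴ * (Q * X * Qᵀ)).trace := by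
    rw [hY, Matrix.mul_assoc Qᵀ, Matrix.mul_assoc Qᵀ, Matrix.mul_assoc Qᵀ, Matrix.trace_mul_comm]
    simp only [Matrix.mul_assoc]
  rw [ht]
  refine ⟨(Matrix.posSemidef_conjTranspose_mul_self _).trace_nonneg, fun h => ?_⟩
  rw [Matrix.trace_conjTranspose_mul_self_eq_zero_iff] at h
  have hQt : IsUnit Qᵀ.det := by rwa [Matrix.det_transpose]
  calc X = Q⁻¹ * (Q * X * Qᵀ) * (Qᵀ)⁻¹ := by
        rw [Matrix.mul_assoc Q, Matrix.nonsing_inv_mul_cancel_left _ _ hQ,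
          Matrix.mul_nonsing_inv_cancel_right _ _ hQt]
    _ = 0 := by rw [h, Matrix.mul_zero, Matrix.zero_mul]

/-- The Riemannian metric at `Θ` as a bilinear form. -/
def metricForm {n m p : ℕ} (Θ : N n m p) : LinearMap.BilinForm ℝ (Triple n m p) :=
  LinearMap.mk₂ ℝ (metric Θ)
    (fun v v' w => by
      show (Θ.1.1.1⁻¹ * (v.1.1 + v'.1.1) * Θ.1.1.1⁻¹ * w.1.1).trace
          + ((v.2.1 + v'.2.1)ᵀ * w.2.1).trace + ((v.2.2 + v'.2.2)ᵀ * w.2.2).trace =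
        ((Θ.1.1.1⁻¹ * v.1.1 * Θ.1.1.1⁻¹ * w.1.1).trace + (v.2.1ᵀ * w.2.1).trace
          + (v.2.2ᵀ * w.2.2).trace) + ((Θ.1.1.1⁻¹ * v'.1.1 * Θ.1.1.1⁻¹ * w.1.1).trace
          + (v'.2.1ᵀ * w.2.1).trace + (v'.2.2ᵀ * w.2.2).trace)
      simp only [Matrix.mul_add, Matrix.add_mul, Matrix.transpose_add, Matrix.trace_add]
      ring)
    (fun c v w => by
      show (Θ.1.1.1⁻¹ * (c • v.1.1) * Θ.1.1.1⁻¹ * w.1.1).trace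
          + ((c • v.2.1)ᵀ * w.2.1).trace + ((c • v.2.2)ᵀ * w.2.2).trace =
        c * ((Θ.1.1.1⁻¹ * v.1.1 * Θ.1.1.1⁻¹ * w.1.1).trace + (v.2.1ᵀ * w.2.1).trace
          + (v.2.2ᵀ * w.2.2).trace)
      simp only [Matrix.mul_smul, Matrix.smul_mul, Matrix.transpose_smul, Matrix.trace_smul,
        smul_eq_mul]
      ring)
    (fun v w w' => by
      show (Θ.1.1.1⁻¹ * v.1.1 * Θ.1.1.1⁻¹ * (w.1.1 + w'.1.1)).trace
          + (v.2.1ᵀ * (w.2.1 + w'.2.1)).trace + (v.2.2ᵀ * (w.2.2 + w'.2.2)).trace =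
        ((Θ.1.1.1⁻¹ * v.1.1 * Θ.1.1.1⁻¹ * w.1.1).trace + (v.2.1ᵀ * w.2.1).trace
          + (v.2.2ᵀ * w.2.2).trace) + ((Θ.1.1.1⁻¹ * v.1.1 * Θ.1.1.1⁻¹ * w'.1.1).trace
          + (v.2.1ᵀ * w'.2.1).trace + (v.2.2ᵀ * w'.2.2).trace)
      simp only [Matrix.mul_add, Matrix.trace_add]
      ring)
    (fun c v w => by
      show (Θ.1.1.1⁻¹ * v.1.1 * Θ.1.1.1⁻¹ * (c • w.1.1)).trace
          + (v.2.1ᵀ * (c • w.2.1)).trace + (v.2.2ᵀ * (c • w.2.2)).trace =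
        c * ((Θ.1.1.1⁻¹ * v.1.1 * Θ.1.1.1⁻¹ * w.1.1).trace + (v.2.1ᵀ * w.2.1).trace
          + (v.2.2ᵀ * w.2.2).trace)
      simp only [Matrix.mul_smul, Matrix.trace_smul, smul_eq_mul]
      ring)

theorem metricForm_apply {n m p : ℕ} (Θ : N n m p) (v w : Triple n m p) :
    metricForm Θ v w = (Θ.1.1.1⁻¹ * v.1.1 * Θ.1.1.1⁻¹ * w.1.1).trace + (v.2.1ᵀ * w.2.1).trace
      + (v.2.2ᵀ * w.2.2).trace := rfl

theorem metricForm_symm {n m p : ℕ} (Θ : N n m p) (v w : Triple n m p) :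
    metricForm Θ v w = metricForm Θ w v := by
  have ht : ∀ {k l : ℕ} (M M' : Matrix (Fin k) (Fin l) ℝ), (Mᵀ * M').trace = (M'ᵀ * M).trace := by
    intro k l M M'
    rw [← Matrix.trace_transpose, Matrix.transpose_mul, Matrix.transpose_transpose]
  rw [metricForm_apply, metricForm_apply, ht v.2.1, ht v.2.2, Matrix.mul_assoc (_ * v.1.1),
    Matrix.trace_mul_comm]
  simp only [Matrix.mul_assoc]

theorem metricForm_pos {n m p : ℕ} (Θ : N n m p) (v : Triple n m p) (h : metricForm Θ v v = 0) :
    v = 0 := by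
  have hP : (Θ.1.1.1⁻¹).PosDef := Θ.2.1.inv
  obtain ⟨h1, h1'⟩ := trace_mul_mul_mul_self_nonneg hP (X := v.1.1) v.1.2
  have ht : ∀ {k l : ℕ} (M : Matrix (Fin k) (Fin l) ℝ),
      0 ≤ (Mᵀ * M).trace ∧ ((Mᵀ * M).trace = 0 → M = 0) := by
    intro k l M
    rw [← Matrix.conjTranspose_eq_transpose_of_trivial]
    exact ⟨(Matrix.posSemidef_conjTranspose_mul_self _).trace_nonneg,
      Matrix.trace_conjTranspose_mul_self_eq_zero_iff.1⟩
  obtain ⟨h2, h2'⟩ := ht v.2.1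
  obtain ⟨h3, h3'⟩ := ht v.2.2
  rw [metricForm_apply] at h
  exact Prod.ext (Subtype.ext (h1' (by linarith)))
    (Prod.ext (h2' (by linarith)) (h3' (by linarith)))

/-- (UᵀAU)⁻¹ = UᵀA⁻¹U, and all factors U Uᵀ cancel under the cyclic trace. Since `act U` is linear,
this says that φ_U is an isometry. -/
theorem metricForm_act {n m p : ℕ} (U : O n) (Θ : N n m p) (v w : Triple n m p) :
    metricForm (phi U Θ) (act U v) (act U w) = metricForm Θ v w := by
  have hinv : (U.1ᵀ * Θ.1.1.1 * U.1)⁻¹ = U.1ᵀ * Θ.1.1.1⁻¹ * U.1 := by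
    have hA : IsUnit Θ.1.1.1.det := isUnit_iff_ne_zero.2 Θ.2.1.det_pos.ne'
    refine Matrix.inv_eq_right_inv ?_
    calc U.1ᵀ * Θ.1.1.1 * U.1 * (U.1ᵀ * Θ.1.1.1⁻¹ * U.1)
        = U.1ᵀ * (Θ.1.1.1 * (U.1 * U.1ᵀ) * Θ.1.1.1⁻¹) * U.1 := by simp only [Matrix.mul_assoc]
      _ = 1 := by
        rw [O_mul_transpose, Matrix.mul_one, Matrix.mul_nonsing_inv _ hA, Matrix.mul_one,
          O_transpose_mul]
  rw [metricForm_apply, metricForm_apply]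
  show ((U.1ᵀ * Θ.1.1.1 * U.1)⁻¹ * (U.1ᵀ * v.1.1 * U.1) * (U.1ᵀ * Θ.1.1.1 * U.1)⁻¹ *
    (U.1ᵀ * w.1.1 * U.1)).trace + ((U.1ᵀ * v.2.1)ᵀ * (U.1ᵀ * w.2.1)).trace +
      ((v.2.2 * U.1)ᵀ * (w.2.2 * U.1)).trace = _
  congr 1
  · congr 1
    · rw [hinv]
      have : U.1ᵀ * Θ.1.1.1⁻¹ * U.1 * (U.1ᵀ * v.1.1 * U.1) * (U.1ᵀ * Θ.1.1.1⁻¹ * U.1) *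
          (U.1ᵀ * w.1.1 * U.1) = U.1ᵀ * (Θ.1.1.1⁻¹ * (U.1 * U.1ᵀ) * v.1.1 * (U.1 * U.1ᵀ) *
            Θ.1.1.1⁻¹ * (U.1 * U.1ᵀ) * w.1.1 * U.1) := by simp only [Matrix.mul_assoc]
      rw [this, Matrix.trace_mul_comm, Matrix.mul_assoc _ U.1]
      simp only [O_mul_transpose, Matrix.mul_one]
    · rw [Matrix.transpose_mul, Matrix.transpose_transpose, Matrix.mul_assoc,
        ← Matrix.mul_assoc U.1, O_mul_transpose, Matrix.one_mul]
  · rw [Matrix.transpose_mul, Matrix.mul_assoc, Matrix.trace_mul_comm]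
    simp only [Matrix.mul_assoc, O_mul_transpose, Matrix.mul_one]

/-! ### Derivatives of the inclusion and of the action -/

/-- The inclusion of `N` has the identity as derivative. -/
theorem hasMFDerivAt_val {n m p : ℕ} (Θ : N n m p) :
    HasMFDerivAt 𝓘(ℝ, Triple n m p) 𝓘(ℝ, Triple n m p) (Subtype.val : N n m p → Triple n m p) Θ
      (ContinuousLinearMap.id ℝ (Triple n m p)) := by
  refine ⟨continuous_subtype_val.continuousAt, ?_⟩
  have h := TopologicalSpace.Opens.chartAt_subtype_val_symm_eventuallyEq (N n m p) (x := Θ)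
    (H := Triple n m p)
  have h1 : HasFDerivAt (Subtype.val ∘ (chartAt (Triple n m p) Θ).symm)
      (ContinuousLinearMap.id ℝ (Triple n m p)) Θ.1 :=
    (hasFDerivAt_id (𝕜 := ℝ) Θ.1).congr_of_eventuallyEq h.symm
  exact h1.hasFDerivWithinAt

/-- The action of `U` as a continuous linear map. -/
def actL (n m p : ℕ) (U : O n) : Triple n m p →L[ℝ] Triple n m p :=
  LinearMap.toContinuousLinearMap
    { toFun := act U
      map_add' := fun v w => by
        refine Prod.ext (Subtype.ext ?_) (Prod.ext (Matrix.mul_add _ _ _) (Matrix.add_mul _ _ _))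
        show U.1ᵀ * (v.1.1 + w.1.1) * U.1 = U.1ᵀ * v.1.1 * U.1 + U.1ᵀ * w.1.1 * U.1
        rw [Matrix.mul_add, Matrix.add_mul]
      map_smul' := fun c v => by
        refine Prod.ext (Subtype.ext ?_)
          (Prod.ext (Matrix.mul_smul _ _ _) (Matrix.smul_mul _ _ _))
        show U.1ᵀ * (c • v.1.1) * U.1 = c • (U.1ᵀ * v.1.1 * U.1)
        rw [Matrix.mul_smul, Matrix.smul_mul] }

theorem contMDiff_phi {n m p : ℕ} (U : O n) :
    ContMDiff 𝓘(ℝ, Triple n m p) 𝓘(ℝ, Triple n m p) ∞ (phi U : N n m p → N n m p) := by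
  rw [← ContMDiff.subtypeVal_comp_iff]
  exact (contDiff_act U).contMDiff.comp contMDiff_subtype_val

theorem mfderiv_phi {n m p : ℕ} (U : O n) (Θ : N n m p) :
    mfderiv 𝓘(ℝ, Triple n m p) 𝓘(ℝ, Triple n m p) (phi U) Θ = actL n m p U := by
  have h1 := HasMFDerivAt.comp Θ (hasMFDerivAt_val (phi U Θ))
    (((contMDiff_phi U) Θ).mdifferentiableAt (by simp)).hasMFDerivAt
  have h2 : HasMFDerivAt 𝓘(ℝ, Triple n m p) 𝓘(ℝ, Triple n m p)
      ((Subtype.val : N n m p → Triple n m p) ∘ phi U) Θ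
      ((actL n m p U).comp (ContinuousLinearMap.id ℝ (Triple n m p))) :=
    HasMFDerivAt.comp (g := actL n m p U) (f := (Subtype.val : N n m p → Triple n m p)) Θ
      (actL n m p U).hasFDerivAt.hasMFDerivAt (hasMFDerivAt_val Θ)
  have h3 := hasMFDerivAt_unique h1 h2
  exact ContinuousLinearMap.ext fun v => DFunLike.congr_fun h3 v

/-! ### The vertical space as the kernel of the projection -/

/-- In a chart of the orbit space, `π` is a smooth submersion `g` between vector spaces whose
level sets are the fibres and whose derivative has the kernel of `Dπ(Θ)`. -/
theorem exists_local_proj {n m p d : ℕ}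
    [ChartedSpace (EuclideanSpace ℝ (Fin d)) (Orbits n m p)] (hQ : IsQuotientManifold n m p d)
    (Θ : N n m p) :
    ∃ (D : Set (Triple n m p)) (g : Triple n m p → EuclideanSpace ℝ (Fin d)), IsOpen D ∧
      D ⊆ carrierN n m p ∧ Θ.1 ∈ D ∧ ContDiffOn ℝ ∞ g D ∧
      (∀ Θ' : N n m p, proj Θ' = proj Θ → Θ'.1 ∈ D ∧ g Θ'.1 = g Θ.1) ∧
      (∀ Θ' : N n m p, Θ'.1 ∈ D → g Θ'.1 = g Θ.1 → proj Θ' = proj Θ) ∧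
      Function.Surjective (fderiv ℝ g Θ.1) ∧
      ∀ v : Triple n m p, fderiv ℝ g Θ.1 v = 0 ↔
        mfderiv 𝓘(ℝ, Triple n m p) (𝓡 d) (proj : N n m p → Orbits n m p) Θ v = 0 := by
  classical
  have := hQ.isManifold
  let f : N n m p → EuclideanSpace ℝ (Fin d) := fun Θ' => extChartAt (𝓡 d) (proj Θ) (proj Θ')
  -- The value 0 off `N` is arbitrary: all later use takes place on the open set `D` inside `N`.
  let g : Triple n m p → EuclideanSpace ℝ (Fin d) := fun x =>
    if h : x ∈ carrierN n m p then f ⟨x, h⟩ else 0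
  have hgf : ∀ Θ' : N n m p, g Θ'.1 = f Θ' := fun Θ' => dif_pos Θ'.2
  let S : Set (Orbits n m p) := (chartAt (EuclideanSpace ℝ (Fin d)) (proj Θ)).source
  have hS : IsOpen (proj ⁻¹' S : Set (N n m p)) :=
    (chartAt (EuclideanSpace ℝ (Fin d)) (proj Θ)).open_source.preimage
      (isOpenQuotientMap_proj n m p).continuous
  -- Being the preimage of a chart domain, `D` contains the whole fibre of `Θ`, so no curve in the
  -- fibre leaves it.
  let D : Set (Triple n m p) := Subtype.val '' (proj ⁻¹' S : Set (N n m p))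
  have hmemD : ∀ Θ' : N n m p, Θ'.1 ∈ D ↔ proj Θ' ∈ S := by
    intro Θ'
    constructor
    · rintro ⟨Θ'', h, he⟩
      rwa [← Subtype.ext he]
    · exact fun h => ⟨Θ', h, rfl⟩
  have hDN : D ⊆ carrierN n m p := by
    rintro _ ⟨Θ', -, rfl⟩
    exact Θ'.2
  have hD : IsOpen D := (N n m p).2.isOpenMap_subtype_val _ hS
  have hΘS : proj Θ ∈ S := mem_chart_source _ _
  have hfs : ∀ Θ' : N n m p, proj Θ' ∈ S →
      ContMDiffAt 𝓘(ℝ, Triple n m p) 𝓘(ℝ, EuclideanSpace ℝ (Fin d)) ∞ f Θ' := fun Θ' h =>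
    (contMDiffAt_extChartAt' (I := 𝓡 d) h).comp Θ' (hQ.contMDiff_proj Θ')
  have hgval : (fun Θ' : N n m p => g Θ'.1) = f := funext hgf
  have hg : ContDiffOn ℝ ∞ g D := by
    rintro _ ⟨Θ', h, rfl⟩
    have h1 : ContMDiffAt 𝓘(ℝ, Triple n m p) 𝓘(ℝ, EuclideanSpace ℝ (Fin d)) ∞
        (fun x : N n m p => g x) Θ' := by
      rw [hgval]
      exact hfs Θ' h
    exact (contMDiffAt_subtype_iff.1 h1).contDiffAt.contDiffWithinAt
  have hgd : HasFDerivAt g (fderiv ℝ g Θ.1) Θ.1 :=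
    ((hg.contDiffAt (hD.mem_nhds ((hmemD Θ).2 hΘS))).differentiableAt (by simp)).hasFDerivAt
  have h1 := (HasMFDerivAt.comp Θ hgd.hasMFDerivAt (hasMFDerivAt_val Θ)).congr_of_eventuallyEq
    (f₁ := f) (Filter.EventuallyEq.of_eq hgval.symm)
  have h2 := HasMFDerivAt.comp Θ
    ((contMDiffAt_extChartAt (I := 𝓡 d) (n := ∞) (x := proj Θ)).mdifferentiableAt
      (by simp)).hasMFDerivAt ((hQ.contMDiff_proj Θ).mdifferentiableAt (by simp)).hasMFDerivAt
  have h3 := hasMFDerivAt_unique h1 h2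
  -- The chart has invertible derivative, so Dg and Dπ share their kernel and surjectivity.
  obtain ⟨e, he⟩ := isInvertible_mfderiv_extChartAt (I := 𝓡 d) (mem_extChartAt_source (proj Θ))
  have h4 : ∀ v : Triple n m p, fderiv ℝ g Θ.1 v =
      e (mfderiv 𝓘(ℝ, Triple n m p) (𝓡 d) (proj : N n m p → Orbits n m p) Θ v) := by
    intro v
    refine (DFunLike.congr_fun h3 v).trans ?_
    exact (DFunLike.congr_fun he _).symm
  refine ⟨D, g, hD, hDN, (hmemD Θ).2 hΘS, hg, fun Θ' h => ⟨?_, ?_⟩, fun Θ' h h' => ?_, ?_, ?_⟩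
  · rw [hmemD, h]
    exact hΘS
  · rw [hgf, hgf]
    exact congrArg (extChartAt (𝓡 d) (proj Θ)) h
  · rw [hgf, hgf] at h'
    rw [hmemD] at h
    exact (extChartAt (𝓡 d) (proj Θ)).injOn (by rwa [extChartAt_source])
      (mem_extChartAt_source _) h'
  · intro w
    obtain ⟨v, hv⟩ := hQ.surjective_mfderiv_proj Θ (e.symm w)
    refine ⟨v, (h4 v).trans ?_⟩
    rw [hv]
    exact e.apply_symm_apply w
  · intro v
    constructor
    · intro h
      exact e.injective (((h4 v).symm.trans h).trans (map_zero e).symm)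
    · intro h
      exact (h4 v).trans ((congrArg e h).trans (map_zero e))

/-- The level sets of a submersion contain smooth curves in all directions tangent to them. -/
theorem exists_curve_in_fibre {E F : Type*} [NormedAddCommGroup E] [NormedSpace ℝ E]
    [CompleteSpace E] [NormedAddCommGroup F] [NormedSpace ℝ F] [FiniteDimensional ℝ F]
    {D : Set E} (hD : IsOpen D) {g : E → F} (hg : ContDiffOn ℝ ∞ g D) {x₀ : E} (hx₀ : x₀ ∈ D)
    (hsurj : Function.Surjective (fderiv ℝ g x₀)) {v : E} (hv : fderiv ℝ g x₀ v = 0) :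
    ∃ γ : ℝ → E, ContDiff ℝ ∞ γ ∧ γ 0 = x₀ ∧ (∀ t, γ t ∈ D ∧ g (γ t) = g x₀) ∧
      HasDerivAt γ v 0 := by
  set g' := fderiv ℝ g x₀ with hg'
  have hgd : HasFDerivAt g g' x₀ :=
    ((hg.contDiffAt (hD.mem_nhds hx₀)).differentiableAt (by simp)).hasFDerivAt
  obtain ⟨s, hs⟩ := g'.exists_rightInverse_of_surjective (LinearMap.range_eq_top.2 hsurj)
  have hs' : ∀ w, g' (s w) = w := fun w => DFunLike.congr_fun hs w
  -- With `s` a right inverse of g', g'(ψ x - x₀) = g x - g x₀: in the coordinates `ψ` the level set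
  -- of `g` becomes the affine space x₀ + ker g'. The curve sought is the preimage of a line in it.
  let ψ : E → E := fun x => x - s (g' (x - x₀)) + s (g x - g x₀)
  have hψ : ContDiffOn ℝ ∞ ψ D :=
    (contDiffOn_id.sub ((s.contDiff.comp g'.contDiff).comp_contDiffOn
      (contDiffOn_id.sub contDiffOn_const))).add
      (s.contDiff.comp_contDiffOn (hg.sub contDiffOn_const))
  have hψ0 : ψ x₀ = x₀ := by simp [ψ]
  have hgψ : ∀ x, g' (ψ x - x₀) = g x - g x₀ := by
    intro x
    simp only [ψ, map_sub, map_add, hs']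
    abel
  have hψd : HasFDerivAt ψ (ContinuousLinearMap.id ℝ E) x₀ := by
    have h := ((hasFDerivAt_id (𝕜 := ℝ) x₀).sub
      (s.hasFDerivAt.comp x₀ (g'.hasFDerivAt.comp x₀
        ((hasFDerivAt_id (𝕜 := ℝ) x₀).sub_const x₀)))).add
      (s.hasFDerivAt.comp x₀ (hgd.sub_const (g x₀)))
    refine h.congr_fderiv ?_
    ext w
    simp
  obtain ⟨φ, hφ, hxφ, hφD, hφs⟩ := exists_local_diffeo hD hψ hx₀ hψd
  have hφ0 : φ x₀ = x₀ := by rw [hφ, hψ0]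
  have hx₀T : x₀ ∈ φ.target := by
    have := φ.map_source hxφ
    rwa [hφ0] at this
  have hsymm0 : φ.symm x₀ = x₀ := by
    conv_lhs => rw [← hφ0]
    exact φ.left_inv hxφ
  have hline : Continuous fun t : ℝ => x₀ + t • v := by fun_prop
  have hnhds : (fun t : ℝ => x₀ + t • v) ⁻¹' φ.target ∈ 𝓝 (0 : ℝ) :=
    hline.continuousAt.preimage_mem_nhds (by simpa using φ.open_target.mem_nhds hx₀T)
  obtain ⟨ε, hε, hball⟩ := Metric.nhds_basis_closedBall.mem_iff.1 hnhds
  -- `vertical` asks for curves defined on all of ℝ. This reparametrization has speed 1 at 0 and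
  -- stays in [-ε, ε], so the line never leaves the target of `φ`.
  let τ : ℝ → ℝ := fun t => ε * Real.sin (ε⁻¹ * t)
  have hτ : ContDiff ℝ ∞ τ :=
    contDiff_const.mul (Real.contDiff_sin.comp (contDiff_const.mul contDiff_id))
  have hτ0 : τ 0 = 0 := by simp [τ]
  have hτd : HasDerivAt τ 1 0 := by
    have h : HasDerivAt τ (ε * (Real.cos (ε⁻¹ * 0) * (ε⁻¹ * 1))) 0 :=
      (((hasDerivAt_id (0 : ℝ)).const_mul ε⁻¹).sin).const_mul ε
    convert h using 1
    simp [hε.ne']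
  have hτT : ∀ t, x₀ + τ t • v ∈ φ.target := by
    intro t
    refine hball (a := τ t) ?_
    rw [mem_closedBall_zero_iff, Real.norm_eq_abs, abs_mul, abs_of_pos hε]
    exact mul_le_of_le_one_right hε.le (Real.abs_sin_le_one _)
  have hlin : ContDiff ℝ ∞ fun t => x₀ + τ t • v := contDiff_const.add (hτ.smul contDiff_const)
  refine ⟨fun t => φ.symm (x₀ + τ t • v), ?_, ?_, fun t => ⟨?_, ?_⟩, ?_⟩
  · exact contDiffOn_univ.1 (hφs.comp hlin.contDiffOn fun t _ => hτT t)
  · simp only [hτ0, zero_smul, add_zero, hsymm0]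
  · exact hφD (φ.map_target (hτT t))
  · have h1 : ψ (φ.symm (x₀ + τ t • v)) = x₀ + τ t • v := by
      rw [← hφ]
      exact φ.right_inv (hτT t)
    have h2 := hgψ (φ.symm (x₀ + τ t • v))
    rw [h1, add_sub_cancel_left, map_smul, hv, smul_zero] at h2
    exact (sub_eq_zero.1 h2.symm)
  · have h1 : HasFDerivAt φ.symm (ContinuousLinearMap.id ℝ E) (x₀ + τ 0 • v) := by
      rw [hτ0, zero_smul, add_zero]
      exact φ.hasFDerivAt_symm (f' := ContinuousLinearEquiv.refl ℝ E) hx₀T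
        (by rw [hsymm0, hφ]; exact hψd)
    have h2 : HasDerivAt (fun t => x₀ + τ t • v) ((1 : ℝ) • v) 0 := (hτd.smul_const v).const_add x₀
    simpa [Function.comp_def] using h1.comp_hasDerivAt (0 : ℝ) h2

/-- A curve in the fibre has constant `g`, so its velocity is killed by Dg; conversely the
submersion property yields a curve for every kernel vector. -/
theorem mem_vertical_iff {n m p d : ℕ}
    [ChartedSpace (EuclideanSpace ℝ (Fin d)) (Orbits n m p)] (hQ : IsQuotientManifold n m p d)
    (Θ : N n m p) (v : TangentSpace 𝓘(ℝ, Triple n m p) Θ) :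
    v ∈ vertical Θ ↔
      mfderiv 𝓘(ℝ, Triple n m p) (𝓡 d) (proj : N n m p → Orbits n m p) Θ v = 0 := by
  obtain ⟨D, g, hD, hDN, hΘD, hg, hfib, hfib', hsurj, hker⟩ := exists_local_proj hQ Θ
  refine Iff.trans ?_ (hker v)
  constructor
  · rintro ⟨γ, -, hγ0, hγ, hγd⟩
    have hgd : HasFDerivAt g (fderiv ℝ g Θ.1) (γ 0).1 := by
      rw [hγ0]
      exact ((hg.contDiffAt (hD.mem_nhds hΘD)).differentiableAt (by simp)).hasFDerivAt
    have h1 := hgd.comp_hasDerivAt (0 : ℝ) hγd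
    have h2 : (g ∘ fun t => (γ t).1) = fun _ => g Θ.1 := funext fun t => (hfib _ (hγ t)).2
    rw [h2] at h1
    exact h1.unique (hasDerivAt_const _ _)
  · intro hv
    obtain ⟨γ, hγs, hγ0, hγ, hγd⟩ := exists_curve_in_fibre hD hg hΘD hsurj hv
    refine ⟨fun t => ⟨γ t, hDN (hγ t).1⟩, ?_, Subtype.ext hγ0, fun t => ?_, hγd⟩
    · rw [← ContMDiff.subtypeVal_comp_iff]
      exact hγs.contMDiff
    · exact hfib' ⟨γ t, hDN (hγ t).1⟩ (hγ t).1 (hγ t).2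

/-! ### Horizontal lifts -/

/-- The base point `q` is a separate variable because the same ξ is lifted at Θ and at φ_U(Θ), whose
projections are equal only by a proof. -/
theorem existsUnique_horizontalLift {n m p d : ℕ}
    [ChartedSpace (EuclideanSpace ℝ (Fin d)) (Orbits n m p)] (hQ : IsQuotientManifold n m p d)
    {q : Orbits n m p} (ξ : TangentSpace (𝓡 d) q) (Θ : N n m p) (hq : proj Θ = q) :
    ∃! h : TangentSpace 𝓘(ℝ, Triple n m p) Θ, IsHorizontalLift ξ Θ h := by
  subst hq
  let f : Triple n m p →ₗ[ℝ] EuclideanSpace ℝ (Fin d) :=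
    (mfderiv 𝓘(ℝ, Triple n m p) (𝓡 d) (proj : N n m p → Orbits n m p) Θ).toLinearMap
  have key : ∀ h : Triple n m p, IsHorizontalLift ξ Θ h ↔
      (∀ v, f v = 0 → metricForm Θ h v = 0) ∧ f h = ξ := by
    intro h
    refine and_congr ?_ ?_
    · exact forall_congr' fun v => imp_congr (mem_vertical_iff hQ Θ v) Iff.rfl
    · exact Bundle.TotalSpace.mk_inj
  obtain ⟨h, hh, hu⟩ := existsUnique_orthogonal_preimage (metricForm Θ) (metricForm_symm Θ)
    (metricForm_pos Θ) f (hQ.surjective_mfderiv_proj Θ) ξ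
  exact ⟨h, (key h).2 hh, fun h' hh' => hu h' ((key h').1 hh')⟩

/-- Differentiating π ∘ φ_U = π shows that Dφ_U preserves the projected vector and matches vertical
vectors at the two points; the isometry property then preserves orthogonality to them. -/
theorem IsHorizontalLift.map_phi {n m p d : ℕ}
    [ChartedSpace (EuclideanSpace ℝ (Fin d)) (Orbits n m p)] (hQ : IsQuotientManifold n m p d)
    {q : Orbits n m p} {ξ : TangentSpace (𝓡 d) q} {Θ : N n m p}
    {h : TangentSpace 𝓘(ℝ, Triple n m p) Θ} (hh : IsHorizontalLift ξ Θ h) (U : O n) :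
    IsHorizontalLift ξ (phi U Θ)
      (mfderiv 𝓘(ℝ, Triple n m p) 𝓘(ℝ, Triple n m p) (phi U) Θ h) := by
  have hπ : (proj ∘ phi U : N n m p → Orbits n m p) = proj := funext (proj_phi U)
  have hπd := (hQ.contMDiff_proj (phi U Θ)).mdifferentiableAt (by simp)
  have hφd := ((contMDiff_phi U) Θ).mdifferentiableAt (by simp)
  refine ⟨fun w hw => ?_, ?_⟩
  · rw [mem_vertical_iff hQ] at hw
    -- Every vertical vector at φ_U(Θ) must be tested, so each is pulled back by U⁻¹ to a vertical
    -- vector at Θ.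
    let v : TangentSpace 𝓘(ℝ, Triple n m p) Θ := act U⁻¹ (w : Triple n m p)
    have hw' : act U (v : Triple n m p) = w :=
      (act_act U⁻¹ U _).trans ((congrArg (act · _) (inv_mul_cancel U)).trans (act_one _))
    have hv : v ∈ vertical Θ := by
      rw [mem_vertical_iff hQ]
      have h1 := mfderiv_comp Θ hπd hφd
      rw [hπ] at h1
      refine (DFunLike.congr_fun h1 v).trans (Eq.trans (congrArg (mfderiv 𝓘(ℝ, Triple n m p) (𝓡 d)
        (proj : N n m p → Orbits n m p) (phi U Θ)) ?_) hw)
      exact (DFunLike.congr_fun (mfderiv_phi U Θ) v).trans hw'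
    have h2 : metricForm (phi U Θ) (act U (h : Triple n m p)) (act U (v : Triple n m p)) = 0 :=
      (metricForm_act U Θ h v).trans (hh.1 v hv)
    rw [hw'] at h2
    rw [mfderiv_phi]
    exact h2
  · have h1 := tangentMap_comp_at (I := 𝓘(ℝ, Triple n m p)) (I' := 𝓘(ℝ, Triple n m p))
      (I'' := 𝓡 d) (⟨Θ, h⟩ : TangentBundle 𝓘(ℝ, Triple n m p) (N n m p)) hπd hφd
    rw [hπ] at h1
    exact h1.symm.trans hh.2

end SymSys

end

open SymSys
theorem theorem3 (n m p : ℕ) :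
    (∃ (d : ℕ) (_ : ChartedSpace (EuclideanSpace ℝ (Fin d)) (Orbits n m p)),
      IsQuotientManifold n m p d) ∧
    ∀ (d : ℕ) [ChartedSpace (EuclideanSpace ℝ (Fin d)) (Orbits n m p)],
      IsQuotientManifold n m p d →
      ∀ (Θ : N n m p) (ξ : TangentSpace (𝓡 d) (proj Θ)) (U : O n),
        (∃! h : TangentSpace 𝓘(ℝ, Triple n m p) Θ, IsHorizontalLift ξ Θ h) ∧
        (∃! h' : TangentSpace 𝓘(ℝ, Triple n m p) (phi U Θ), IsHorizontalLift ξ (phi U Θ) h') ∧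
        ∀ (h : TangentSpace 𝓘(ℝ, Triple n m p) Θ)
          (h' : TangentSpace 𝓘(ℝ, Triple n m p) (phi U Θ)),
          IsHorizontalLift ξ Θ h → IsHorizontalLift ξ (phi U Θ) h' →
            h' = mfderiv 𝓘(ℝ, Triple n m p) 𝓘(ℝ, Triple n m p) (phi U) Θ h := by
  refine ⟨⟨orbitDim n m p, orbitChartedSpace n m p, isQuotientManifold_orbits n m p⟩, ?_⟩
  intro d _ hQ Θ ξ U
  have hU := existsUnique_horizontalLift hQ ξ (phi U Θ) (proj_phi U Θ)
  exact ⟨existsUnique_horizontalLift hQ ξ Θ rfl, hU,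
    fun h h' hh hh' => hU.unique hh' (hh.map_phi hQ U)⟩
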